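/- Let $x_1,x_2,\dots$ be random variables on a probability space $(\Omega,\mathfrak F,\mathbf P_0)$, all having (no contamination, $\epsilon=0$) the same density $f_0$, where $f_0$ is bounded and symmetric about zero. For $N\ge 1$ and $b>0$ put $\theta_N=\frac1N\sum_{i=1}^N x_i$, $I_1(b)=\{i\le N:|x_i-\theta_N|<b\}$, $I_2(b)=\{i\le N:|x_i-\theta_N|\ge b\}$, $N_j(b)=\# I_j(b)$, and $$\Psi_N(b)=\frac1{N^2}\Bigl(N_2(b)\sum_{i\in I_1(b)}x_i-N_1(b)\sum_{i\in I_2(b)}x_i\Bigr).$$ Assume the uniform Cramér condition: there is $T>0$ with $\mathbf E_0\,e^{t x_i}<\infty$ for all $i$ and all $|t|<T$. (a) Suppose $(x_i)$ is $\psi$-mixing, that is, $\psi(n)\to0$ as $n\to\infty$, where $$\psi(n)=\sup_{t\ge1}\ \sup\Bigl\{\Bigl|\frac{\mathbf P_0(A\cap D)}{\mathbf P_0(A)\mathbf P_0(D)}-1\Bigr| : A\in\sigma(x_i,\ i\le t),\ D\in\sigma(x_i,\ i\ge t+n),\ \mathbf P_0(A)\mathbf P_0(D)\ne0\Bigr\}.$$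 Then for all $0<\kappa<B$ there are a constant $L_1>0$ and a function $L_2:(0,\infty)\to(0,\infty)$ such that for every $C>0$ and every $N\ge1$ $$\mathbf P_0\Bigl\{\sup_{b\in[\kappa,B]}|\Psi_N(b)|>C\Bigr\}\le L_1\exp(-L_2(C)\,N).$$ (b) Suppose $(x_i)$ is $\psi$-weakly dependent with exponentially decaying coefficients: there are numbers $\theta_r\ge0$ and $\beta>0$ with $\theta_r\le e^{-\beta r}$ for $r\ge 1$, $\theta_r\to0$, and a function $\psi$ such that for all $n,m,r\ge1$, all bounded Lipschitz $f:\mathbb R^n\to\mathbb R$, $h:\mathbb R^m\to\mathbb R$ and all indices $i_1\le\dots\le i_n<i_n+r<j_1\le\dots\le j_m$ $$|\mathrm{Cov}(f(x_{i_1},\dots,x_{i_n}),h(x_{j_1},\dots,x_{j_m}))|\le\psi(f,h,n,m)\,\theta_r,$$ where $0\le\psi(f,h,n,m)\le A^{n+m}(1+\|f\|_\infty+\mathrm{Lip} f)(1+\|h\|_\infty+\mathrm{Lip}\,h)$ for some constant $A\ge1$ (Lipschitz constants with respect to the $\ell^1$ distance). Then for all $0<\kappa<B$ there are a constant $L_1>0$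 and a function $L_2:(0,\infty)\to(0,\infty)$ such that for every $C>0$ and every $N\ge1$ $$\mathbf P_0\Bigl\{\sup_{b\in[\kappa,B]}|\Psi_N(b)|>C\Bigr\}\le L_1\exp(-L_2(C)\sqrt N).$$ -/

import Mathlib

open MeasureTheory ProbabilityTheory Filter Topology
open scoped ENNReal

/-! ### The separation statistic (samples `x 0, …, x (N-1)`) -/

/-- The sample mean `θ_N = (1/N) ∑ x_i`. -/
noncomputable def sampleMean (N : ℕ) (x : ℕ → ℝ) : ℝ :=
  (1 / (N : ℝ)) * ∑ i ∈ Finset.range N, x i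

/-- Indices of the sub-sample `X₁(b)` of ordinary observations: `|x_i - θ_N| < b`. -/
noncomputable def ordinaryIdx (N : ℕ) (x : ℕ → ℝ) (b : ℝ) : Finset ℕ :=
  {i ∈ Finset.range N | |x i - sampleMean N x| < b}

/-- Indices of the sub-sample `X₂(b)` of abnormal observations: `|x_i - θ_N| ≥ b`. -/
noncomputable def abnormalIdx (N : ℕ) (x : ℕ → ℝ) (b : ℝ) : Finset ℕ :=
  {i ∈ Finset.range N | b ≤ |x i - sampleMean N x|}

/-- `Ψ_N(b) = (1/N²) (N₂ ∑_{X₁(b)} x - N₁ ∑_{X₂(b)} x)`, with `N₁, N₂` the sub-sample sizes. -/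
noncomputable def sepStat (N : ℕ) (x : ℕ → ℝ) (b : ℝ) : ℝ :=
  (1 / (N : ℝ) ^ 2) *
    (((abnormalIdx N x b).card : ℝ) * ∑ i ∈ ordinaryIdx N x b, x i
      - ((ordinaryIdx N x b).card : ℝ) * ∑ i ∈ abnormalIdx N x b, x i)

/-- `sup_{b ∈ [κ, B]} |Ψ_N(b)|`. For a fixed sample only finitely many values occur, so that for
`κ ≤ B` this is the supremum of a nonempty bounded set. -/
noncomputable def sepStatSup (N : ℕ) (x : ℕ → ℝ) (κ B : ℝ) : ℝ :=
  sSup ((fun b => |sepStat N x b|) '' Set.Icc κ B)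

/-! ### Mixing -/

/-- `ψ(H₁, H₂) = sup |P(AB) / (P(A) P(B)) - 1|` over `A ∈ H₁`, `B ∈ H₂` with `P(A) P(B) ≠ 0`. -/
noncomputable def psiDep {Ω : Type*} [MeasurableSpace Ω] (P : Measure Ω)
    (H₁ H₂ : MeasurableSpace Ω) : ℝ≥0∞ :=
  ⨆ (A : Set Ω) (_ : MeasurableSet[H₁] A) (B : Set Ω) (_ : MeasurableSet[H₂] B)
    (_ : P.real A * P.real B ≠ 0),
    ENNReal.ofReal |P.real (A ∩ B) / (P.real A * P.real B) - 1|

/-- The σ-algebra generated by `y i`, `i ≤ t`. -/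
abbrev pastSigma {Ω : Type*} (y : ℕ → Ω → ℝ) (t : ℕ) : MeasurableSpace Ω :=
  ⨆ (i : ℕ) (_ : i ≤ t), MeasurableSpace.comap (y i) inferInstance

/-- The σ-algebra generated by `y i`, `i ≥ s`. -/
abbrev futureSigma {Ω : Type*} (y : ℕ → Ω → ℝ) (s : ℕ) : MeasurableSpace Ω :=
  ⨆ (i : ℕ) (_ : s ≤ i), MeasurableSpace.comap (y i) inferInstance

/-- The `ψ`-mixing coefficient `ψ(n)` of the sequence `y`. -/
noncomputable def psiMixingCoeff {Ω : Type*} [MeasurableSpace Ω] (P : Measure Ω)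
    (y : ℕ → Ω → ℝ) (n : ℕ) : ℝ≥0∞ :=
  ⨆ t : ℕ, psiDep P (pastSigma y t) (futureSigma y (t + n))

/-- The `ψ`-mixing condition: `ψ(n) → 0`. -/
def IsPsiMixing {Ω : Type*} [MeasurableSpace Ω] (P : Measure Ω) (y : ℕ → Ω → ℝ) : Prop :=
  Tendsto (psiMixingCoeff P y) atTop (𝓝 0)

/-! ### Weak dependence -/

/-- `(θ, 𝓛, ψ)`-weak dependence of the sequence `X`. -/
structure IsWeakDependent {Ω : Type*} [MeasurableSpace Ω] (P : Measure Ω) (X : ℕ → Ω → ℝ)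
    (θ : ℕ → ℝ) (𝓛 : ∀ n : ℕ, Set ((Fin n → ℝ) → ℝ))
    (ψ : ∀ n m : ℕ, ((Fin n → ℝ) → ℝ) → ((Fin m → ℝ) → ℝ) → ℝ) : Prop where
  nonneg : ∀ r, 0 ≤ θ r
  tendsto_zero : Tendsto θ atTop (𝓝 0)
  cov_le : ∀ n m r : ℕ, 1 ≤ n → 1 ≤ m → 1 ≤ r →
    ∀ f ∈ 𝓛 n, ∀ h ∈ 𝓛 m, ∀ (i : Fin n → ℕ) (j : Fin m → ℕ), Monotone i → Monotone j →
      (∀ a b, i a + r < j b) →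
      |covariance (fun ω => f (fun a => X (i a) ω)) (fun ω => h (fun b => X (j b) ω)) P|
        ≤ ψ n m f h * θ r

/-- `f` is bounded by `M` and `L`-Lipschitz for the `ℓ¹` distance on `ℝⁿ`. -/
def BoundedLipschitzWith {n : ℕ} (M L : ℝ) (f : (Fin n → ℝ) → ℝ) : Prop :=
  (∀ u, |f u| ≤ M) ∧ ∀ u v, |f u - f v| ≤ L * ∑ a, |u a - v a|

/-- The class of bounded Lipschitz functions on `ℝⁿ`. -/
def boundedLipschitz (n : ℕ) : Set ((Fin n → ℝ) → ℝ) :=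
  {f | ∃ M L : ℝ, BoundedLipschitzWith M L f}

/-- `ψ` is nonnegative on bounded Lipschitz functions and of at most exponential growth in the
dimensions:
`ψ(f, h, n, m) ≤ A ^ (n + m) (1 + ‖f‖_∞ + Lip f) (1 + ‖h‖_∞ + Lip h)` for some `A`. -/
def HasExpGrowth (ψ : ∀ n m : ℕ, ((Fin n → ℝ) → ℝ) → ((Fin m → ℝ) → ℝ) → ℝ) : Prop :=
  ∃ A : ℝ, 1 ≤ A ∧ ∀ n m : ℕ, 1 ≤ n → 1 ≤ m →
    ∀ (f : (Fin n → ℝ) → ℝ) (h : (Fin m → ℝ) → ℝ) (M L M' L' : ℝ),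
      BoundedLipschitzWith M L f → BoundedLipschitzWith M' L' h →
      0 ≤ ψ n m f h ∧ ψ n m f h ≤ A ^ (n + m) * (1 + M + L) * (1 + M' + L')

/-! ### Cramér's condition -/

/-- The uniform Cramér condition: one `T > 0` with `E exp(t y_i) < ∞` for all `i` and `|t| < T`. -/
def UniformCramer {Ω : Type*} [MeasurableSpace Ω] (P : Measure Ω) (y : ℕ → Ω → ℝ) : Prop :=
  ∃ T : ℝ, 0 < T ∧ ∀ i : ℕ, ∀ t : ℝ, |t| < T → Integrable (fun ω => Real.exp (t * y i ω)) P

/-! By `sepStat_eq`, the statistic is the mean of `(x_i - θ_N) 1_{|x_i - θ_N| < b}`. If `|θ_N| ≤ δ`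
and `b` lies within `δ` of a grid point `r`, each term is at most `G_r (x_i)`, where the Lipschitz
function `G_r` (`cutMajorant`) consists of an odd function, of mean zero under the symmetric law,
and of terms whose mean is `O(δ)` because the density is bounded. Minus the statistic is bounded in
the same way by the `G_r (-x_i)`. So, for `δ` small in terms of `C`, a large supremum forces one of
finitely many Lipschitz observables (the `G_r (± x_i)`, and `± x_i` itself for the event
`|θ_N| > δ`) to have an empirical mean above a level that exceeds its expectation
(`HasUpperDeviation.isExpSmall_sepStatSup`). It remains to see that such deviations are
exponentially unlikely, at speed `N` or `√N`.

An observable can be truncated from below (`HasUpperDeviation.of_lipschitz`), so let `g ≥ 0`. Its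
sum over `N` indices is split into residue classes modulo `p`, and the Chernoff bound is applied in
each class, with a parameter `t` for which `E exp (t g)` is close to `exp (t E g)`.

* Under `ψ`-mixing, `p` is a constant: the expectation of the product over a class factorizes up to
  a factor `1 + ψ(p)` per variable (`lintegral_prod_le_psiMixing`), and one `p` with `ψ(p)` small is
  enough (`IsPsiMixing.hasUpperDeviation`).
* Under weak dependence the classes have `k ~ √(N/s)` elements and `p = s k`. The covariance bound
  needs bounded Lipschitz functions of `k` variables whose size is `exp (O(k))`, although `g` is
  unbounded. These are the functions `exp (t min (∑ g(u_a)) m)` with `m` the level of the deviation,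
  a multiple of `k`: since `min · m` is subadditive on nonnegative numbers, their expectations
  factorize one variable at a time (`integral_truncExpSum_succ_le`), and the truncation costs nothing
  in Markov's inequality (`measure_class_sum_ge_le`). For `s` large, `exp (-β s k)` beats all the
  errors (`IsWeakDependent.hasUpperDeviation`).
-/

/-! ### Exponentially small sequences of events -/

/-- The events `E N` have probability `O(exp (-a * ρ N))` for some `a > 0`: they are exponentially
small at speed `ρ`. -/
def IsExpSmall {Ω : Type*} [MeasurableSpace Ω] (P : Measure Ω) (ρ : ℕ → ℝ)
    (E : ℕ → Set Ω) : Prop :=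
  ∃ K a : ℝ, 0 < a ∧ ∀ N : ℕ, 1 ≤ N → P.real (E N) ≤ K * Real.exp (-(a * ρ N))

section ExpSmall

variable {Ω : Type*} [MeasurableSpace Ω] {P : Measure Ω} {ρ : ℕ → ℝ}

theorem IsExpSmall.mono [IsFiniteMeasure P] {E F : ℕ → Set Ω} (hF : IsExpSmall P ρ F)
    (h : ∀ N, 1 ≤ N → E N ⊆ F N) : IsExpSmall P ρ E := by
  obtain ⟨K, a, ha, hK⟩ := hF
  exact ⟨K, a, ha, fun N hN => (measureReal_mono (h N hN)).trans (hK N hN)⟩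

theorem isExpSmall_empty : IsExpSmall P ρ (fun _ => ∅) :=
  ⟨0, 1, one_pos, fun N _ => by simp⟩

theorem IsExpSmall.union (hρ : ∀ N, 0 ≤ ρ N) {E F : ℕ → Set Ω}
    (hE : IsExpSmall P ρ E) (hF : IsExpSmall P ρ F) : IsExpSmall P ρ (fun N => E N ∪ F N) := by
  obtain ⟨K, a, ha, hK⟩ := hE
  obtain ⟨K', a', ha', hK'⟩ := hF
  refine ⟨|K| + |K'|, min a a', lt_min ha ha', fun N hN => ?_⟩
  have h1 : Real.exp (-(a * ρ N)) ≤ Real.exp (-(min a a' * ρ N)) :=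
    Real.exp_le_exp.2 (neg_le_neg (mul_le_mul_of_nonneg_right (min_le_left _ _) (hρ N)))
  have h2 : Real.exp (-(a' * ρ N)) ≤ Real.exp (-(min a a' * ρ N)) :=
    Real.exp_le_exp.2 (neg_le_neg (mul_le_mul_of_nonneg_right (min_le_right _ _) (hρ N)))
  calc P.real (E N ∪ F N) ≤ P.real (E N) + P.real (F N) := measureReal_union_le _ _
    _ ≤ |K| * Real.exp (-(a * ρ N)) + |K'| * Real.exp (-(a' * ρ N)) := by
        gcongr
        · exact (hK N hN).trans (by gcongr; exact le_abs_self K)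
        · exact (hK' N hN).trans (by gcongr; exact le_abs_self K')
    _ ≤ _ := by
        rw [add_mul]; gcongr

theorem IsExpSmall.biUnion (hρ : ∀ N, 0 ≤ ρ N) {ι : Type*} (s : Finset ι)
    {E : ι → ℕ → Set Ω} (hE : ∀ j ∈ s, IsExpSmall P ρ (E j)) :
    IsExpSmall P ρ (fun N => ⋃ j ∈ s, E j N) := by
  classical
  induction s using Finset.induction_on with
  | empty => simpa using isExpSmall_empty
  | insert j s _ ih =>
    simp only [Finset.set_biUnion_insert]
    exact (hE j (Finset.mem_insert_self j s)).union hρ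
      (ih fun i hi => hE i (Finset.mem_insert_of_mem hi))

/-- A finite number of exceptional `N` is absorbed by the prefactor. -/
theorem IsExpSmall.of_eventually [IsProbabilityMeasure P] {E : ℕ → Set Ω} {K a : ℝ} (ha : 0 < a)
    (h : ∀ᶠ N in atTop, P.real (E N) ≤ K * Real.exp (-(a * ρ N))) : IsExpSmall P ρ E := by
  obtain ⟨N₀, hN₀⟩ := eventually_atTop.1 h
  have hS : 0 ≤ ∑ n ∈ Finset.range N₀, Real.exp (a * ρ n) :=
    Finset.sum_nonneg fun _ _ => (Real.exp_pos _).le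
  refine ⟨|K| + ∑ n ∈ Finset.range N₀, Real.exp (a * ρ n), a, ha, fun N _ => ?_⟩
  rcases le_or_gt N₀ N with hN | hN
  · refine (hN₀ N hN).trans ?_
    gcongr
    linarith [le_abs_self K]
  · refine (measureReal_le_one (μ := P)).trans ?_
    rw [Real.exp_neg, ← div_eq_mul_inv, one_le_div (Real.exp_pos _)]
    have := Finset.single_le_sum (f := fun n => Real.exp (a * ρ n))
      (fun _ _ => (Real.exp_pos _).le) (Finset.mem_range.2 hN)
    linarith [abs_nonneg K]

/-- Probabilities are at most `1`, so the prefactor can be made the universal constant `e` at the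
price of a smaller rate. -/
theorem IsExpSmall.exists_rate [IsProbabilityMeasure P] {E : ℕ → Set Ω}
    (hE : IsExpSmall P ρ E) :
    ∃ a : ℝ, 0 < a ∧ ∀ N, 1 ≤ N →
      P.real (E N) ≤ Real.exp 1 * Real.exp (-(a * ρ N)) := by
  obtain ⟨K, a, ha, hK⟩ := hE
  set l := max 0 (Real.log K)
  have hl : 0 ≤ l := le_max_left _ _
  refine ⟨a / (1 + l), by positivity, fun N hN => ?_⟩
  rw [← Real.exp_add]
  have hp := hK N hN
  rcases le_or_gt (a * ρ N) (1 + l) with h | h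
  · refine (measureReal_le_one (μ := P)).trans (Real.one_le_exp ?_)
    have : a / (1 + l) * ρ N ≤ 1 := by
      rw [div_mul_eq_mul_div, div_le_one (by positivity)]; exact h
    linarith
  · rcases le_or_gt K 0 with hK0 | hK0
    · exact (hp.trans (mul_nonpos_of_nonpos_of_nonneg hK0 (Real.exp_pos _).le)).trans
        (Real.exp_pos _).le
    · refine hp.trans ?_
      rw [← Real.exp_log hK0, ← Real.exp_add]
      refine Real.exp_le_exp.2 ?_
      have h1 : Real.log K ≤ l := le_max_right _ _
      have h2 : a * ρ N = (1 + l) * (a / (1 + l) * ρ N) := by field_simp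
      have h3 : 1 < a / (1 + l) * ρ N := by
        rw [h2] at h
        exact lt_of_mul_lt_mul_left (by linarith) (by positivity : 0 ≤ 1 + l)
      nlinarith

end ExpSmall

/-! ### Exponential moments -/

section Moments

variable {Ω : Type*} [MeasurableSpace Ω] {P : Measure Ω}

/-- A slight excess `c` over the mean dominates the moment generating function for some small
positive parameter, because `mgf` has derivative `P[X] < c` at `0`. -/
theorem exists_pos_mgf_le [IsProbabilityMeasure P] {X : Ω → ℝ}
    (hX : 0 ∈ interior (integrableExpSet X P)) {c : ℝ} (hc : P[X] < c) :
    ∃ t : ℝ, 0 < t ∧ Integrable (fun ω => Real.exp (t * X ω)) P ∧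
      ∫ ω, Real.exp (t * X ω) ∂P ≤ Real.exp (t * c) := by
  have hd : HasDerivAt (fun t => mgf X P t - Real.exp (t * c)) (P[X] - c) 0 := by
    have h1 := hasDerivAt_mgf hX
    have h2 : HasDerivAt (fun t : ℝ => Real.exp (t * c)) c 0 := by
      simpa using ((hasDerivAt_id (0 : ℝ)).mul_const c).exp
    simp only [zero_mul, Real.exp_zero, mul_one] at h1
    exact h1.sub h2
  have hs := hd.tendsto_slope_zero_right
  have hneg := hs.eventually (gt_mem_nhds (sub_neg.2 hc))
  have hint : ∀ᶠ t in 𝓝[>] (0 : ℝ), t ∈ integrableExpSet X P :=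
    nhdsWithin_le_nhds (mem_interior_iff_mem_nhds.1 hX)
  obtain ⟨t, ht, hti, ht0⟩ := (hneg.and (hint.and self_mem_nhdsWithin)).exists
  have ht0 : 0 < t := ht0
  refine ⟨t, ht0, hti, ?_⟩
  simp only [zero_add, mgf_zero, zero_mul, Real.exp_zero, sub_self, sub_zero, smul_eq_mul] at ht
  have := (mul_neg_iff.1 ht).resolve_right (fun h => absurd h.1 (not_lt.2 (inv_pos.2 ht0).le))
  have h2 := this.2
  rw [mgf] at h2
  linarith

/-- Cramér's condition passes from the variables to their Lipschitz images. -/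
theorem UniformCramer.zero_mem_interior {x : ℕ → Ω → ℝ} (h : UniformCramer P x)
    (hx : ∀ i, Measurable (x i)) {g : ℝ → ℝ} {L : NNReal} (hg : LipschitzWith L g) (i : ℕ) :
    0 ∈ interior (integrableExpSet (fun ω => g (x i ω)) P) := by
  obtain ⟨T, hT, h⟩ := h
  rw [mem_interior_iff_mem_nhds]
  have hs : 0 < T / (L + 1) := by positivity
  filter_upwards [Ioo_mem_nhds (neg_lt_zero.2 hs) hs] with t ht
  have ht' : |t| < T / (L + 1) := abs_lt.2 ht
  have htL : |t * L| < T := by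
    rw [abs_mul, abs_of_nonneg (NNReal.coe_nonneg L)]
    rw [lt_div_iff₀ (by positivity)] at ht'
    nlinarith [abs_nonneg t]
  have h1 := h i (t * L) htL
  have h2 := h i (-(t * L)) (by rwa [abs_neg])
  refine Integrable.mono' ((h1.add h2).const_mul (Real.exp (|t| * |g 0|)))
    (((hg.continuous.measurable.comp (hx i)).const_mul t).exp.aestronglyMeasurable)
    (ae_of_all _ fun ω => ?_)
  simp only [Pi.add_apply, Real.norm_eq_abs, Real.abs_exp]
  have hgl : |g (x i ω)| ≤ |g 0| + L * |x i ω| := by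
    have := hg.dist_le_mul (x i ω) 0
    rw [Real.dist_eq, Real.dist_eq, sub_zero] at this
    have h3 := abs_sub_abs_le_abs_sub (g (x i ω)) (g 0)
    linarith
  have h4 : t * g (x i ω) ≤ |t| * |g 0| + |t * L * x i ω| := by
    calc t * g (x i ω) ≤ |t| * |g (x i ω)| := by rw [← abs_mul]; exact le_abs_self _
      _ ≤ |t| * (|g 0| + L * |x i ω|) := by gcongr
      _ = _ := by rw [abs_mul, abs_mul, abs_of_nonneg (NNReal.coe_nonneg L)]; ring
  calc Real.exp (t * g (x i ω)) ≤ Real.exp (|t| * |g 0| + |t * L * x i ω|) :=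
        Real.exp_le_exp.2 h4
    _ = Real.exp (|t| * |g 0|) * Real.exp (|t * L * x i ω|) := Real.exp_add _ _
    _ ≤ _ := by
      gcongr
      rw [neg_mul]
      exact Real.exp_abs_le _

theorem integral_comp_eq_of_map_eq {X Y : Ω → ℝ} (hX : Measurable X) (hY : Measurable Y)
    (h : P.map X = P.map Y) {F : ℝ → ℝ} (hF : Measurable F) :
    ∫ ω, F (X ω) ∂P = ∫ ω, F (Y ω) ∂P := by
  rw [← integral_map hX.aemeasurable hF.aestronglyMeasurable, h,
    integral_map hY.aemeasurable hF.aestronglyMeasurable]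

end Moments

/-! ### Splitting a sum into residue classes -/

/-- Over at least `N` indices, grouped by residue modulo `p`, the sum of nonnegative terms only
increases. -/
theorem sum_range_le_sum_residue {y : ℕ → ℝ} (hy : ∀ i, 0 ≤ y i) {N p k : ℕ} (h : N ≤ p * k) :
    ∑ i ∈ Finset.range N, y i
      ≤ ∑ r ∈ Finset.range p, ∑ j ∈ Finset.range k, y (r + p * j) := by
  have hsplit : ∀ k : ℕ, ∑ i ∈ Finset.range (p * k), y i
      = ∑ r ∈ Finset.range p, ∑ j ∈ Finset.range k, y (r + p * j) := by
    intro k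
    induction k with
    | zero => simp
    | succ k ih =>
      rw [mul_add, mul_one, Finset.sum_range_add, ih, ← Finset.sum_add_distrib]
      refine Finset.sum_congr rfl fun r _ => ?_
      rw [Finset.sum_range_succ, add_comm r]
  rw [← hsplit]
  exact Finset.sum_le_sum_of_subset_of_nonneg (Finset.range_mono h) fun i _ _ => hy i

/-- If the sum of `N` nonnegative terms is large, then so is the sum along one of the `p` residue
classes. -/
theorem measure_sum_ge_le_of_residue {Ω : Type*} [MeasurableSpace Ω] {P : Measure Ω}
    [IsFiniteMeasure P] {y : ℕ → Ω → ℝ} (hy : ∀ i ω, 0 ≤ y i ω) {N p k : ℕ} (hp : 1 ≤ p)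
    (h : N ≤ p * k) {c d q : ℝ} (hcd : d * k * p ≤ c * N)
    (hq : ∀ r, P.real {ω | d * k ≤ ∑ j ∈ Finset.range k, y (r + p * j) ω} ≤ q) :
    P.real {ω | c * N ≤ ∑ i ∈ Finset.range N, y i ω} ≤ p * q := by
  have hsub : {ω | c * N ≤ ∑ i ∈ Finset.range N, y i ω} ⊆
      ⋃ r ∈ Finset.range p, {ω | d * k ≤ ∑ j ∈ Finset.range k, y (r + p * j) ω} := by
    intro ω hω
    by_contra hcon
    simp only [Set.mem_iUnion, Set.mem_ofPred_eq, not_exists, not_le] at hcon hω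
    have hlt : ∑ r ∈ Finset.range p, ∑ j ∈ Finset.range k, y (r + p * j) ω
        < ∑ r ∈ Finset.range p, d * k :=
      Finset.sum_lt_sum_of_nonempty ⟨0, Finset.mem_range.2 hp⟩ hcon
    have := sum_range_le_sum_residue (fun i => hy i ω) h
    rw [Finset.sum_const, Finset.card_range, nsmul_eq_mul] at hlt
    linarith
  refine (measureReal_mono hsub (measure_ne_top _ _)).trans ((measureReal_biUnion_finset_le _ _).trans ?_)
  refine (Finset.sum_le_sum fun r _ => hq r).trans ?_
  simp

/-! ### Upper deviations of Lipschitz observables -/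

/-- Means of nonnegative Lipschitz observables of the sequence `x` exceed a level `c` above the
expectation only with exponentially small probability, at speed `ρ`. The expectation is that of
the first variable, as all the variables will have the same law. -/
def HasUpperDeviation {Ω : Type*} [MeasurableSpace Ω] (P : Measure Ω) (x : ℕ → Ω → ℝ)
    (ρ : ℕ → ℝ) : Prop :=
  ∀ (g : ℝ → ℝ) (L : NNReal), LipschitzWith L g → (∀ u, 0 ≤ g u) →
    ∀ c, ∫ ω, g (x 0 ω) ∂P < c →
      IsExpSmall P ρ (fun N => {ω | c * N ≤ ∑ i ∈ Finset.range N, g (x i ω)})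

/-! ### Upper deviations under `ψ`-mixing -/

section PsiMixing

theorem measure_inter_le_psiDep {Ω : Type*} {H₁ H₂ : MeasurableSpace Ω} [mΩ : MeasurableSpace Ω]
    {P : Measure Ω} [IsProbabilityMeasure P]
    {A D : Set Ω} (hA : MeasurableSet[H₁] A) (hD : MeasurableSet[H₂] D) :
    P (A ∩ D) ≤ (1 + psiDep P H₁ H₂) * P A * P D := by
  by_cases h0 : P.real A * P.real D = 0
  · have : P (A ∩ D) = 0 := by
      rcases mul_eq_zero.1 h0 with h | h
      · exact measure_mono_null Set.inter_subset_left ((measureReal_eq_zero_iff).1 h)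
      · exact measure_mono_null Set.inter_subset_right ((measureReal_eq_zero_iff).1 h)
    rw [this]; exact zero_le
  · set q := P.real (A ∩ D) / (P.real A * P.real D) - 1 with hq
    have hψ : ENNReal.ofReal |q| ≤ psiDep P H₁ H₂ :=
      le_iSup_of_le A <| le_iSup_of_le hA <| le_iSup_of_le D <| le_iSup_of_le hD <|
        le_iSup_of_le h0 le_rfl
    have hr : P.real (A ∩ D) ≤ (1 + |q|) * P.real A * P.real D := by
      have : P.real (A ∩ D) = (1 + q) * (P.real A * P.real D) := by
        rw [hq, add_sub_cancel, div_mul_cancel₀ _ h0]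
      rw [this, mul_assoc]
      gcongr
      exact le_abs_self q
    rw [← ofReal_measureReal (μ := P) (s := A ∩ D)]
    refine (ENNReal.ofReal_le_ofReal hr).trans ?_
    rw [ENNReal.ofReal_mul (by positivity), ENNReal.ofReal_mul (by positivity),
      ENNReal.ofReal_add zero_le_one (abs_nonneg q), ofReal_measureReal, ofReal_measureReal,
      ENNReal.ofReal_one]
    gcongr

/-- The mixing bound for events extends to nonnegative functions, one factor at a time, by
comparing measures on the two sub-σ-algebras. -/
theorem lintegral_mul_le_psiDep {Ω : Type*} {H₁ H₂ : MeasurableSpace Ω} [mΩ : MeasurableSpace Ω]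
    {P : Measure Ω} [IsProbabilityMeasure P]
    (h₁ : H₁ ≤ mΩ) (h₂ : H₂ ≤ mΩ) {f g : Ω → ℝ≥0∞} (hf : Measurable[H₁] f)
    (hg : Measurable[H₂] g) :
    ∫⁻ ω, f ω * g ω ∂P ≤ (1 + psiDep P H₁ H₂) * (∫⁻ ω, f ω ∂P) * ∫⁻ ω, g ω ∂P := by
  have hA : ∀ A, MeasurableSet[H₁] A →
      ∫⁻ ω in A, g ω ∂P ≤ (1 + psiDep P H₁ H₂) * P A * ∫⁻ ω, g ω ∂P := by
    intro A hA
    have hle : (P.restrict A).trim h₂ ≤ (((1 + psiDep P H₁ H₂) * P A) • P.trim h₂) := by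
      rw [Measure.le_iff]
      intro D hD
      rw [trim_measurableSet_eq h₂ hD, Measure.restrict_apply (h₂ _ hD), Measure.smul_apply,
        trim_measurableSet_eq h₂ hD, Set.inter_comm]
      exact measure_inter_le_psiDep hA hD
    rw [← lintegral_trim h₂ hg, ← lintegral_trim h₂ hg, ← smul_eq_mul,
      ← lintegral_smul_measure]
    exact lintegral_mono' hle le_rfl
  have hle : (P.withDensity g).trim h₁ ≤
      (((1 + psiDep P H₁ H₂) * ∫⁻ ω, g ω ∂P) • P.trim h₁) := by
    rw [Measure.le_iff]
    intro A hA'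
    rw [trim_measurableSet_eq h₁ hA', withDensity_apply _ (h₁ _ hA'), Measure.smul_apply,
      trim_measurableSet_eq h₁ hA', smul_eq_mul, mul_right_comm]
    exact hA A hA'
  calc ∫⁻ ω, f ω * g ω ∂P = ∫⁻ ω, f ω ∂(P.withDensity g) := by
        rw [lintegral_withDensity_eq_lintegral_mul _ (hg.mono h₂ le_rfl) (hf.mono h₁ le_rfl)]
        simp [mul_comm]
    _ ≤ ((1 + psiDep P H₁ H₂) * ∫⁻ ω, g ω ∂P) * ∫⁻ ω, f ω ∂P := by
        rw [← lintegral_trim h₁ hf, ← lintegral_trim h₁ hf, ← smul_eq_mul _ (lintegral _ _),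
          ← lintegral_smul_measure]
        exact lintegral_mono' hle le_rfl
    _ = _ := by ring

theorem measurable_pastSigma {Ω : Type*} (x : ℕ → Ω → ℝ) {i t : ℕ} (h : i ≤ t) :
    Measurable[pastSigma x t] (x i) :=
  (comap_measurable (x i)).mono (le_iSup₂_of_le i h le_rfl) le_rfl

theorem measurable_futureSigma {Ω : Type*} (x : ℕ → Ω → ℝ) {i t : ℕ} (h : t ≤ i) :
    Measurable[futureSigma x t] (x i) :=
  (comap_measurable (x i)).mono (le_iSup₂_of_le i h le_rfl) le_rfl

variable {Ω : Type*} [mΩ : MeasurableSpace Ω] {P : Measure Ω}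

/-- Along a residue class modulo `p` the expectation of a product factorizes up to a factor
`1 + ψ(p)` for each variable. -/
theorem lintegral_prod_le_psiMixing [IsProbabilityMeasure P] {x : ℕ → Ω → ℝ}
    (hx : ∀ i, Measurable (x i)) {F : ℝ → ℝ≥0∞} (hF : Measurable F) {v : ℝ≥0∞}
    (hv : ∀ i, ∫⁻ ω, F (x i ω) ∂P ≤ v) (r p k : ℕ) :
    ∫⁻ ω, ∏ j ∈ Finset.range k, F (x (r + p * j) ω) ∂P
      ≤ ((1 + psiMixingCoeff P x p) * v) ^ k := by
  induction k with
  | zero => simp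
  | succ k ih =>
    simp only [Finset.prod_range_succ]
    rcases k with _ | k
    · simp only [Finset.range_zero, Finset.prod_empty, one_mul, zero_add, pow_one]
      exact (hv _).trans (le_mul_of_one_le_left' le_self_add)
    · have hpast : pastSigma x (r + p * k) ≤ mΩ :=
        iSup₂_le fun i _ => (hx i).comap_le
      have hfut : futureSigma x (r + p * k + p) ≤ mΩ :=
        iSup₂_le fun i _ => (hx i).comap_le
      have hf : Measurable[pastSigma x (r + p * k)]
          (fun ω => ∏ j ∈ Finset.range (k + 1), F (x (r + p * j) ω)) := by
        refine Finset.measurable_prod _ fun j hj => hF.comp (measurable_pastSigma x ?_)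
        have := Nat.mul_le_mul_left p (Nat.lt_succ_iff.1 (Finset.mem_range.1 hj))
        omega
      have hg : Measurable[futureSigma x (r + p * k + p)]
          (fun ω => F (x (r + p * (k + 1)) ω)) :=
        hF.comp (measurable_futureSigma x (by rw [mul_add]; omega))
      have hψ : psiDep P (pastSigma x (r + p * k)) (futureSigma x (r + p * k + p))
          ≤ psiMixingCoeff P x p :=
        le_iSup (fun t => psiDep P (pastSigma x t) (futureSigma x (t + p))) (r + p * k)
      refine (lintegral_mul_le_psiDep hpast hfut hf hg).trans ?_
      calc _ ≤ (1 + psiMixingCoeff P x p) * ((1 + psiMixingCoeff P x p) * v) ^ (k + 1) * v := by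
            gcongr
            exact hv _
        _ = _ := by ring

theorem IsPsiMixing.hasUpperDeviation [IsProbabilityMeasure P] {x : ℕ → Ω → ℝ}
    (hmix : IsPsiMixing P x) (hx : ∀ i, Measurable (x i))
    (hlaw : ∀ i, P.map (x i) = P.map (x 0)) (hcr : UniformCramer P x) :
    HasUpperDeviation P x (fun N => (N : ℝ)) := by
  intro g L hg hg0 c hc
  -- `E g < e < d < c`: `e` bounds the moment generating function, `d` is the level per class, and
  -- the gap between `d` and `c` absorbs the rounding of the class sizes
  obtain ⟨e, hce, hec⟩ := exists_between hc
  obtain ⟨d, hed, hdc⟩ := exists_between hec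
  obtain ⟨t, ht, hti, hte⟩ := exists_pos_mgf_le (hcr.zero_mem_interior hx hg 0) hce
  set F : ℝ → ℝ≥0∞ := fun u => ENNReal.ofReal (Real.exp (t * g u))
  have hexpm : Measurable fun u => Real.exp (t * g u) :=
    (hg.continuous.measurable.const_mul t).exp
  have hF : Measurable F := hexpm.ennreal_ofReal
  have hv : ∀ i, ∫⁻ ω, F (x i ω) ∂P ≤ ENNReal.ofReal (Real.exp (t * e)) := by
    intro i
    have : ∫⁻ ω, F (x i ω) ∂P = ∫⁻ ω, F (x 0 ω) ∂P := by
      rw [← lintegral_map hF (hx i), hlaw i, lintegral_map hF (hx 0)]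
    rw [this, ← ofReal_integral_eq_lintegral_ofReal hti
      (ae_of_all _ fun _ => (Real.exp_pos _).le)]
    exact ENNReal.ofReal_le_ofReal hte
  set a := t * (d - e) / 2 with ha_def
  have ha : 0 < a := by have := sub_pos.2 hed; positivity
  -- one gap `p` suffices: its mixing coefficient costs half of the gain of the Chernoff bound
  have hpos : (0 : ℝ≥0∞) < ENNReal.ofReal (Real.exp a - 1) :=
    ENNReal.ofReal_pos.2 (sub_pos.2 (Real.one_lt_exp_iff.2 ha))
  obtain ⟨p, hψ, hp⟩ := ((hmix.eventually (gt_mem_nhds hpos)).and (eventually_ge_atTop 1)).exists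
  have hψ' : 1 + psiMixingCoeff P x p ≤ ENNReal.ofReal (Real.exp a) := by
    have : ENNReal.ofReal (Real.exp a) = 1 + ENNReal.ofReal (Real.exp a - 1) := by
      rw [← ENNReal.ofReal_one,
        ← ENNReal.ofReal_add zero_le_one (sub_nonneg.2 (Real.one_le_exp ha.le))]
      congr 1; ring
    rw [this]
    gcongr
  have hclass : ∀ k r : ℕ, P.real {ω | d * k ≤ ∑ j ∈ Finset.range k, g (x (r + p * j) ω)}
      ≤ Real.exp (-(a * k)) := by
    intro k r
    have hset : {ω | d * k ≤ ∑ j ∈ Finset.range k, g (x (r + p * j) ω)} ⊆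
        {ω | ENNReal.ofReal (Real.exp (t * (d * k)))
          ≤ ∏ j ∈ Finset.range k, F (x (r + p * j) ω)} := by
      intro ω hω
      rw [Set.mem_ofPred_eq] at hω ⊢
      rw [← ENNReal.ofReal_prod_of_nonneg (fun _ _ => (Real.exp_pos _).le), ← Real.exp_sum,
        ← Finset.mul_sum]
      gcongr
    have hmeas : Measurable fun ω => ∏ j ∈ Finset.range k, F (x (r + p * j) ω) :=
      Finset.measurable_prod _ fun j _ => hF.comp (hx _)
    have hle : P {ω | d * k ≤ ∑ j ∈ Finset.range k, g (x (r + p * j) ω)}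
        ≤ ENNReal.ofReal (Real.exp (-(a * k))) := by
      refine (measure_mono hset).trans ((meas_ge_le_lintegral_div hmeas.aemeasurable
        (ENNReal.ofReal_pos.2 (Real.exp_pos _)).ne' ENNReal.ofReal_ne_top).trans ?_)
      rw [ENNReal.div_le_iff (ENNReal.ofReal_pos.2 (Real.exp_pos _)).ne' ENNReal.ofReal_ne_top]
      refine (lintegral_prod_le_psiMixing hx hF hv r p k).trans ?_
      calc _ ≤ (ENNReal.ofReal (Real.exp a) * ENNReal.ofReal (Real.exp (t * e))) ^ k := by gcongr
        _ = _ := by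
          rw [← ENNReal.ofReal_mul (Real.exp_pos _).le, ← ENNReal.ofReal_pow (by positivity),
            ← ENNReal.ofReal_mul (Real.exp_pos _).le, ← Real.exp_add, ← Real.exp_nat_mul,
            ← Real.exp_add]
          congr 2
          rw [ha_def]; ring
    exact ENNReal.toReal_le_of_le_ofReal (Real.exp_pos _).le hle
  have hp0 : (0 : ℝ) < p := by exact_mod_cast hp
  refine IsExpSmall.of_eventually (K := p) (a := a / p) (by positivity) ?_
  have hlarge : ∀ᶠ N : ℕ in atTop, d * p / (c - d) ≤ N :=
    tendsto_natCast_atTop_atTop.eventually_ge_atTop _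
  filter_upwards [hlarge] with N hN
  have hd0 : 0 ≤ d := by
    have : 0 ≤ ∫ ω, g (x 0 ω) ∂P := integral_nonneg fun _ => hg0 _
    linarith
  have hk1 : N ≤ p * (N / p + 1) := (Nat.lt_mul_div_succ N hp).le
  have hk2 : ((N / p + 1 : ℕ) : ℝ) * p ≤ N + p := by
    have := Nat.div_mul_le_self N p
    have h2 : (N / p + 1) * p ≤ N + p := by rw [add_mul]; omega
    exact_mod_cast h2
  have hcd : d * ((N / p + 1 : ℕ) : ℝ) * p ≤ c * N := by
    rw [div_le_iff₀ (sub_pos.2 hdc)] at hN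
    nlinarith [mul_le_mul_of_nonneg_left hk2 hd0]
  refine (measure_sum_ge_le_of_residue (fun i ω => hg0 _) hp hk1 hcd
    (hclass (N / p + 1))).trans ?_
  refine mul_le_mul_of_nonneg_left (Real.exp_le_exp.2 (neg_le_neg ?_)) hp0.le
  rw [div_mul_eq_mul_div, div_le_iff₀ hp0]
  have : (N : ℝ) ≤ p * (N / p + 1 : ℕ) := by exact_mod_cast hk1
  nlinarith

end PsiMixing

/-! ### Upper deviations under weak dependence -/

/-- The truncated exponential of a sum: `u ↦ exp (t * min (∑ g (u a)) m)`. -/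
noncomputable def truncExpSum (g : ℝ → ℝ) (t m : ℝ) {n : ℕ} (u : Fin n → ℝ) : ℝ :=
  Real.exp (t * min (∑ a, g (u a)) m)

section TruncExp

variable {g : ℝ → ℝ} {t m : ℝ}

theorem truncExpSum_pos {n : ℕ} (u : Fin n → ℝ) : 0 < truncExpSum g t m u := Real.exp_pos _

theorem truncExpSum_le (ht : 0 ≤ t) {n : ℕ} (u : Fin n → ℝ) :
    truncExpSum g t m u ≤ Real.exp (t * m) :=
  Real.exp_le_exp.2 (mul_le_mul_of_nonneg_left (min_le_right _ _) ht)

theorem measurable_truncExpSum (hg : Measurable g) {n : ℕ} :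
    Measurable (truncExpSum g t m : (Fin n → ℝ) → ℝ) := by
  unfold truncExpSum
  fun_prop

theorem abs_exp_sub_exp_le {a b c : ℝ} (ha : a ≤ c) (hb : b ≤ c) :
    |Real.exp a - Real.exp b| ≤ Real.exp c * |a - b| := by
  wlog hab : b ≤ a generalizing a b
  · rw [abs_sub_comm, abs_sub_comm a]
    exact this hb ha (le_of_not_ge hab)
  rw [abs_of_nonneg (sub_nonneg.2 (Real.exp_le_exp.2 hab)), abs_of_nonneg (sub_nonneg.2 hab)]
  have h1 : Real.exp b = Real.exp a * Real.exp (b - a) := by rw [← Real.exp_add]; ring_nf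
  have h2 := Real.add_one_le_exp (b - a)
  calc Real.exp a - Real.exp b = Real.exp a * (1 - Real.exp (b - a)) := by rw [h1]; ring
    _ ≤ Real.exp a * (a - b) :=
        mul_le_mul_of_nonneg_left (by linarith) (Real.exp_pos a).le
    _ ≤ Real.exp c * (a - b) := by
      have := sub_nonneg.2 hab
      gcongr

theorem boundedLipschitzWith_truncExpSum {L : NNReal} (hg : LipschitzWith L g) (ht : 0 ≤ t)
    (n : ℕ) : BoundedLipschitzWith (Real.exp (t * m)) (t * L * Real.exp (t * m))
      (truncExpSum g t m : (Fin n → ℝ) → ℝ) := by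
  refine ⟨fun u => ?_, fun u w => ?_⟩
  · rw [abs_of_pos (truncExpSum_pos u)]
    exact truncExpSum_le ht u
  · have hmin : |min (∑ a, g (u a)) m - min (∑ a, g (w a)) m| ≤ L * ∑ a, |u a - w a| := by
      refine (abs_min_sub_min_le_max _ _ _ _).trans ?_
      rw [sub_self, abs_zero, max_eq_left (abs_nonneg _), ← Finset.sum_sub_distrib,
        Finset.mul_sum]
      refine (Finset.abs_sum_le_sum_abs _ _).trans (Finset.sum_le_sum fun a _ => ?_)
      simpa [Real.dist_eq] using hg.dist_le_mul (u a) (w a)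
    refine (abs_exp_sub_exp_le (c := t * m)
      (mul_le_mul_of_nonneg_left (min_le_right _ _) ht)
      (mul_le_mul_of_nonneg_left (min_le_right _ _) ht)).trans ?_
    rw [← mul_sub, abs_mul, abs_of_nonneg ht]
    calc _ ≤ Real.exp (t * m) * (t * (L * ∑ a, |u a - w a|)) := by gcongr
      _ = _ := by ring

/-- Truncation at `m` is subadditive on nonnegative numbers, so the truncated exponential of a sum
is at most the product of truncated exponentials. -/
theorem truncExpSum_succ_le (hg0 : ∀ u, 0 ≤ g u) (ht : 0 ≤ t) (hm : 0 ≤ m) {n : ℕ}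
    (y : ℕ → ℝ) :
    truncExpSum g t m (fun a : Fin (n + 1) => y a)
      ≤ truncExpSum g t m (fun a : Fin n => y a)
        * truncExpSum g t m (fun _ : Fin 1 => y n) := by
  unfold truncExpSum
  rw [← Real.exp_add, ← mul_add]
  refine Real.exp_le_exp.2 (mul_le_mul_of_nonneg_left ?_ ht)
  simp only [Fin.sum_univ_castSucc, Fin.val_castSucc, Fin.val_last, Finset.univ_unique,
    Finset.sum_const, Finset.card_singleton, one_smul]
  have h1 : 0 ≤ ∑ a : Fin n, g (y a) := Finset.sum_nonneg fun _ _ => hg0 _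
  have h2 := hg0 (y n)
  rcases le_total (∑ a : Fin n, g (y a)) m with h | h
  · rcases le_total (g (y n)) m with h' | h'
    · rw [min_eq_left h, min_eq_left h']; exact min_le_left _ _
    · rw [min_eq_left h, min_eq_right h']
      exact (min_le_right _ _).trans (by linarith)
  · rw [min_eq_right h]
    refine (min_le_right _ _).trans ?_
    rcases le_total (g (y n)) m with h' | h'
    · rw [min_eq_left h']; linarith
    · rw [min_eq_right h']
      exact le_add_of_nonneg_right hm

end TruncExp

section WeakDependence

variable {Ω : Type*} [MeasurableSpace Ω] {P : Measure Ω}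

theorem memLp_truncExpSum [IsFiniteMeasure P] {x : ℕ → Ω → ℝ} (hx : ∀ i, Measurable (x i))
    {g : ℝ → ℝ} (hg : Measurable g) {t : ℝ} (ht : 0 ≤ t) (m : ℝ) {n : ℕ} (i : Fin n → ℕ)
    (q : ℝ≥0∞) : MemLp (fun ω => truncExpSum g t m (fun a => x (i a) ω)) q P := by
  refine MemLp.of_bound (((measurable_truncExpSum hg).comp
    (measurable_pi_lambda _ fun a => hx (i a))).aestronglyMeasurable) (Real.exp (t * m))
    (ae_of_all _ fun ω => ?_)
  rw [Real.norm_eq_abs, abs_of_pos (truncExpSum_pos _)]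
  exact truncExpSum_le ht _

/-- Adding one more variable at distance more than `q` multiplies the expectation of the truncated
exponential by at most the moment generating function `v`, up to the covariance bound. -/
theorem integral_truncExpSum_succ_le [IsProbabilityMeasure P] {x : ℕ → Ω → ℝ}
    (hx : ∀ i, Measurable (x i)) {θ : ℕ → ℝ}
    {ψ : ∀ n m : ℕ, ((Fin n → ℝ) → ℝ) → ((Fin m → ℝ) → ℝ) → ℝ}
    (hwd : IsWeakDependent P x θ boundedLipschitz ψ) {A : ℝ}
    (hA : ∀ n m : ℕ, 1 ≤ n → 1 ≤ m →
      ∀ (f : (Fin n → ℝ) → ℝ) (h : (Fin m → ℝ) → ℝ) (M L M' L' : ℝ),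
        BoundedLipschitzWith M L f → BoundedLipschitzWith M' L' h →
        0 ≤ ψ n m f h ∧ ψ n m f h ≤ A ^ (n + m) * (1 + M + L) * (1 + M' + L'))
    {g : ℝ → ℝ} {L : NNReal} (hg : LipschitzWith L g) (hg0 : ∀ u, 0 ≤ g u) {t : ℝ} (ht : 0 ≤ t)
    {m : ℝ} (hm : 0 ≤ m) {v : ℝ}
    (hv : ∀ i, ∫ ω, Real.exp (t * g (x i ω)) ∂P ≤ v)
    (hint : ∀ i, Integrable (fun ω => Real.exp (t * g (x i ω))) P)
    {p : ℕ} (hp : 2 ≤ p) (r : ℕ) {n : ℕ} (hn : 1 ≤ n) :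
    ∫ ω, truncExpSum g t m (fun a : Fin (n + 1) => x (r + p * a) ω) ∂P
      ≤ v * ∫ ω, truncExpSum g t m (fun a : Fin n => x (r + p * a) ω) ∂P
        + A ^ (n + 1) * (1 + Real.exp (t * m) + t * L * Real.exp (t * m)) ^ 2 * θ (p - 1) := by
  have hgm := hg.continuous.measurable
  set X : Ω → ℝ := fun ω => truncExpSum g t m (fun a : Fin n => x (r + p * a) ω) with hX
  set Y : Ω → ℝ := fun ω => truncExpSum g t m (fun _ : Fin 1 => x (r + p * n) ω) with hY
  have hX2 : MemLp X 2 P := memLp_truncExpSum hx hgm ht m (fun a : Fin n => r + p * a) 2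
  have hY2 : MemLp Y 2 P := memLp_truncExpSum hx hgm ht m (fun _ : Fin 1 => r + p * n) 2
  have hbl := fun k => boundedLipschitzWith_truncExpSum (m := m) hg ht k
  have hcov := hwd.cov_le n 1 (p - 1) hn le_rfl (by omega) _ ⟨_, _, hbl n⟩ _ ⟨_, _, hbl 1⟩
    (fun a => r + p * a) (fun _ => r + p * n)
    (fun a b hab => Nat.add_le_add_left (Nat.mul_le_mul_left p (Fin.le_def.1 hab)) r)
    (fun _ _ _ => le_rfl) (by
      intro a _
      have := Nat.mul_le_mul_left p (Nat.succ_le_of_lt a.2)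
      rw [Nat.succ_eq_add_one, mul_add] at this
      omega)
  have hcov' : cov[X, Y; P]
      ≤ A ^ (n + 1) * (1 + Real.exp (t * m) + t * L * Real.exp (t * m)) ^ 2 * θ (p - 1) := by
    refine (le_abs_self _).trans (hcov.trans ?_)
    refine mul_le_mul_of_nonneg_right ?_ (hwd.nonneg _)
    exact ((hA n 1 hn le_rfl _ _ _ _ _ _ (hbl n) (hbl 1)).2).trans (by rw [mul_assoc, sq])
  have hYv : P[Y] ≤ v := by
    refine le_trans (integral_mono (hY2.integrable one_le_two) (hint (r + p * n)) fun ω => ?_)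
      (hv (r + p * n))
    simp only [hY, truncExpSum, Finset.univ_unique, Finset.sum_const, Finset.card_singleton,
      one_smul]
    exact Real.exp_le_exp.2 (mul_le_mul_of_nonneg_left (min_le_left _ _) ht)
  have hX0 : 0 ≤ P[X] := integral_nonneg fun ω => (truncExpSum_pos _).le
  have hsub := covariance_eq_sub hX2 hY2
  calc _ ≤ ∫ ω, X ω * Y ω ∂P :=
        integral_mono ((memLp_truncExpSum hx hgm ht m
          (fun a : Fin (n + 1) => r + p * a) 2).integrable one_le_two)
          (hX2.integrable_mul hY2)
          fun ω => truncExpSum_succ_le hg0 ht hm (fun a => x (r + p * a) ω)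
    _ = P[X] * P[Y] + cov[X, Y; P] := by rw [hsub]; simp
    _ ≤ P[X] * v + _ := add_le_add (mul_le_mul_of_nonneg_left hYv hX0) hcov'
    _ = _ := by rw [mul_comm v]

/-- Chernoff bound along a residue class modulo `p`. -/
theorem measure_class_sum_ge_le [IsProbabilityMeasure P] {x : ℕ → Ω → ℝ}
    (hx : ∀ i, Measurable (x i)) {θ : ℕ → ℝ}
    {ψ : ∀ n m : ℕ, ((Fin n → ℝ) → ℝ) → ((Fin m → ℝ) → ℝ) → ℝ}
    (hwd : IsWeakDependent P x θ boundedLipschitz ψ) {A : ℝ} (hA1 : 1 ≤ A)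
    (hA : ∀ n m : ℕ, 1 ≤ n → 1 ≤ m →
      ∀ (f : (Fin n → ℝ) → ℝ) (h : (Fin m → ℝ) → ℝ) (M L M' L' : ℝ),
        BoundedLipschitzWith M L f → BoundedLipschitzWith M' L' h →
        0 ≤ ψ n m f h ∧ ψ n m f h ≤ A ^ (n + m) * (1 + M + L) * (1 + M' + L'))
    {g : ℝ → ℝ} {L : NNReal} (hg : LipschitzWith L g) (hg0 : ∀ u, 0 ≤ g u) {t : ℝ} (ht : 0 ≤ t)
    {m : ℝ} (hm : 0 ≤ m) {v : ℝ} (hv1 : 1 ≤ v)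
    (hv : ∀ i, ∫ ω, Real.exp (t * g (x i ω)) ∂P ≤ v)
    (hint : ∀ i, Integrable (fun ω => Real.exp (t * g (x i ω))) P)
    {p : ℕ} (hp : 2 ≤ p) (r : ℕ) {k : ℕ} (hk : 1 ≤ k) {τ : ℝ}
    (hτ : A ^ k * (1 + Real.exp (t * m) + t * L * Real.exp (t * m)) ^ 2 * θ (p - 1) ≤ τ) :
    P.real {ω | m ≤ ∑ j ∈ Finset.range k, g (x (r + p * j) ω)}
      ≤ Real.exp (-(t * m)) * (v ^ k * (1 + k * τ)) := by
  have hτ0 : 0 ≤ τ := le_trans (by have := hwd.nonneg (p - 1); positivity) hτ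
  have hgm := hg.continuous.measurable
  have hind : ∀ n : ℕ, 1 ≤ n → n ≤ k →
      ∫ ω, truncExpSum g t m (fun a : Fin n => x (r + p * a) ω) ∂P ≤ v ^ n * (1 + n * τ) := by
    intro n hn
    induction n, hn using Nat.le_induction with
    | base =>
      intro _
      have h1 : ∫ ω, truncExpSum g t m (fun a : Fin 1 => x (r + p * a) ω) ∂P ≤ v := by
        refine le_trans (integral_mono ((memLp_truncExpSum hx hgm ht m
          (fun a : Fin 1 => r + p * a) 2).integrable one_le_two) (hint r) fun ω => ?_) (hv r)
        simp only [truncExpSum, Finset.univ_unique, Finset.sum_singleton, Fin.default_eq_zero,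
          Fin.val_zero, mul_zero, add_zero]
        exact Real.exp_le_exp.2 (mul_le_mul_of_nonneg_left (min_le_left _ _) ht)
      refine h1.trans ?_
      rw [pow_one, Nat.cast_one, one_mul]
      exact le_mul_of_one_le_right (by linarith) (by linarith)
    | succ n hn ih =>
      intro hnk
      have hstep := integral_truncExpSum_succ_le hx hwd hA hg hg0 ht hm hv hint hp r hn
      have hpow : A ^ (n + 1) ≤ A ^ k := pow_le_pow_right₀ hA1 hnk
      have hτn : A ^ (n + 1) * (1 + Real.exp (t * m) + t * L * Real.exp (t * m)) ^ 2 * θ (p - 1)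
          ≤ τ := by
        refine le_trans ?_ hτ
        have := hwd.nonneg (p - 1)
        gcongr
      have hvn : 1 ≤ v ^ (n + 1) := one_le_pow₀ hv1
      calc _ ≤ v * (v ^ n * (1 + n * τ)) + τ := by
            refine hstep.trans (add_le_add ?_ hτn)
            exact mul_le_mul_of_nonneg_left (ih (by omega)) (by linarith)
        _ ≤ v * (v ^ n * (1 + n * τ)) + v ^ (n + 1) * τ := by
            gcongr
            exact le_mul_of_one_le_left hτ0 hvn
        _ = _ := by push_cast; ring
  have hmark := mul_meas_ge_le_integral_of_nonneg (μ := P)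
    (f := fun ω => truncExpSum g t m (fun a : Fin k => x (r + p * a) ω))
    (ae_of_all _ fun ω => (truncExpSum_pos _).le)
    ((memLp_truncExpSum hx hgm ht m (fun a : Fin k => r + p * a) 2).integrable one_le_two)
    (Real.exp (t * m))
  have hset : {ω | m ≤ ∑ j ∈ Finset.range k, g (x (r + p * j) ω)} ⊆
      {ω | Real.exp (t * m) ≤ truncExpSum g t m (fun a : Fin k => x (r + p * a) ω)} := by
    intro ω hω
    simp only [Set.mem_ofPred_eq, truncExpSum] at hω ⊢
    rw [Fin.sum_univ_eq_sum_range (fun j => g (x (r + p * j) ω)) k, min_eq_right hω]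
  have hle := (mul_le_mul_of_nonneg_left (measureReal_mono (μ := P) hset)
    (Real.exp_pos (t * m)).le).trans (hmark.trans (hind k hk le_rfl))
  rw [Real.exp_neg, ← div_eq_inv_mul, le_div_iff₀ (Real.exp_pos _), mul_comm]
  exact hle

theorem exists_poly_mul_exp_le {a τ : ℝ} (ha : 0 < a) (hτ : 0 ≤ τ) :
    ∃ K : ℝ, 0 ≤ K ∧ ∀ k : ℝ, 0 ≤ k →
      k * (1 + k * τ) * Real.exp (-(a * k)) ≤ K * Real.exp (-(a / 2 * k)) := by
  refine ⟨4 / a * (1 + 4 / a * τ), by positivity, fun k hk => ?_⟩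
  set E := Real.exp (a / 4 * k) with hE
  have hkE : k ≤ 4 / a * E := by
    have h := Real.add_one_le_exp (a / 4 * k)
    rw [div_mul_eq_mul_div, le_div_iff₀ ha]
    linarith
  have hE1 : 1 ≤ E := Real.one_le_exp (by positivity)
  have h2 : 1 + k * τ ≤ (1 + 4 / a * τ) * E := by
    have := mul_le_mul_of_nonneg_right hkE hτ
    nlinarith
  have h3 : k * (1 + k * τ) ≤ (4 / a * E) * ((1 + 4 / a * τ) * E) :=
    mul_le_mul hkE h2 (by positivity) (by positivity)
  calc _ ≤ (4 / a * E) * ((1 + 4 / a * τ) * E) * Real.exp (-(a * k)) := by gcongr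
    _ = 4 / a * (1 + 4 / a * τ) * (E * E * Real.exp (-(a * k))) := by ring
    _ = _ := by
      rw [hE, ← Real.exp_add, ← Real.exp_add]
      congr 2
      ring

/-- The rate `√N` comes from residue classes of about `√N` variables at mutual distance about
`s √N`: for `s` large, the factor `exp (-β s √N)` of the covariance bound beats its growth
`exp (O(√N))` in the number of variables and in the truncation level. -/
theorem IsWeakDependent.hasUpperDeviation [IsProbabilityMeasure P] {x : ℕ → Ω → ℝ}
    {θ : ℕ → ℝ} {ψ : ∀ n m : ℕ, ((Fin n → ℝ) → ℝ) → ((Fin m → ℝ) → ℝ) → ℝ} {β : ℝ}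
    (hwd : IsWeakDependent P x θ boundedLipschitz ψ) (hψ : HasExpGrowth ψ) (hβ : 0 < β)
    (hθ : ∀ r : ℕ, 1 ≤ r → θ r ≤ Real.exp (-(β * (r : ℝ)))) (hx : ∀ i, Measurable (x i))
    (hlaw : ∀ i, P.map (x i) = P.map (x 0)) (hcr : UniformCramer P x) :
    HasUpperDeviation P x (fun N => Real.sqrt N) := by
  intro g L hg hg0 c hc
  obtain ⟨A, hA1, hA⟩ := hψ
  obtain ⟨e, hce, hec⟩ := exists_between hc
  obtain ⟨d, hed, hdc⟩ := exists_between hec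
  obtain ⟨t, ht, hti, hte⟩ := exists_pos_mgf_le (hcr.zero_mem_interior hx hg 0) hce
  have hE0 : 0 ≤ ∫ ω, g (x 0 ω) ∂P := integral_nonneg fun _ => hg0 _
  have he0 : 0 < e := by linarith
  have hd0 : 0 < d := by linarith
  have hexpm : Measurable fun u => Real.exp (t * g u) :=
    (hg.continuous.measurable.const_mul t).exp
  have hint : ∀ i, Integrable (fun ω => Real.exp (t * g (x i ω))) P := by
    intro i
    have h0 := (integrable_map_measure hexpm.aestronglyMeasurable (hx 0).aemeasurable).2 hti
    rw [← hlaw i] at h0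
    exact (integrable_map_measure hexpm.aestronglyMeasurable (hx i).aemeasurable).1 h0
  have hv : ∀ i, ∫ ω, Real.exp (t * g (x i ω)) ∂P ≤ Real.exp (t * e) := fun i =>
    (integral_comp_eq_of_map_eq (hx i) (hx 0) (hlaw i) hexpm).trans_le hte
  obtain ⟨s, hs⟩ := exists_nat_ge (max 2 ((Real.log A + 2 * (t * d)) / β))
  have hs2 : 2 ≤ s := by exact_mod_cast (le_max_left _ _).trans hs
  have hsβ : Real.log A + 2 * (t * d) ≤ β * s := by
    have := (le_max_right _ _).trans hs
    rw [div_le_iff₀ hβ] at this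
    linarith
  set W := 2 + t * L with hW
  set τ := W ^ 2 * Real.exp β with hτ_def
  set a := t * (d - e) with ha_def
  have ha : 0 < a := mul_pos ht (sub_pos.2 hed)
  have hclass : ∀ k r : ℕ, 1 ≤ k →
      P.real {ω | d * k ≤ ∑ j ∈ Finset.range k, g (x (r + s * k * j) ω)}
        ≤ (1 + k * τ) * Real.exp (-(a * k)) := by
    intro k r hk
    have hsk : s ≤ s * k := Nat.le_mul_of_pos_right s hk
    have hm0 : 0 ≤ t * (d * k) := by positivity
    have hτ : A ^ k * (1 + Real.exp (t * (d * k)) + t * L * Real.exp (t * (d * k))) ^ 2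
        * θ (s * k - 1) ≤ τ := by
      have h1 : 1 + Real.exp (t * (d * k)) + t * L * Real.exp (t * (d * k))
          ≤ W * Real.exp (t * (d * k)) := by
        have := Real.one_le_exp hm0
        rw [hW]; linarith
      have h2 := hθ (s * k - 1) (by omega)
      rw [Nat.cast_sub (by omega)] at h2
      have h3 : A ^ k = Real.exp (k * Real.log A) := by
        rw [Real.exp_nat_mul, Real.exp_log (by linarith)]
      have h4 := hwd.nonneg (s * k - 1)
      calc _ ≤ A ^ k * (W * Real.exp (t * (d * k))) ^ 2
              * Real.exp (-(β * ((s * k : ℕ) - (1 : ℕ) : ℝ))) := by gcongr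
        _ = W ^ 2 * Real.exp (β + k * (Real.log A + 2 * (t * d) - β * s)) := by
            rw [h3, mul_pow, ← Real.exp_nat_mul,
              show ∀ x y z w : ℝ, x * (y * z) * w = y * (x * z * w) from fun _ _ _ _ => by ring,
              ← Real.exp_add, ← Real.exp_add]
            congr 2
            push_cast
            ring
        _ ≤ τ := by
            rw [hτ_def]
            gcongr
            have : (k : ℝ) * (Real.log A + 2 * (t * d) - β * s) ≤ 0 :=
              mul_nonpos_of_nonneg_of_nonpos (by positivity) (by linarith)
            linarith
    refine (measure_class_sum_ge_le hx hwd hA1 hA hg hg0 ht.le (by positivity)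
      (Real.one_le_exp (by positivity)) hv hint (by omega) r hk hτ).trans (le_of_eq ?_)
    rw [← Real.exp_nat_mul, ← mul_assoc, ← Real.exp_add, mul_comm]
    congr 2
    rw [ha_def]; ring
  obtain ⟨K, hK0, hK⟩ := exists_poly_mul_exp_le ha (by positivity : 0 ≤ τ)
  refine IsExpSmall.of_eventually (K := s * K) (a := a / (2 * s)) (by positivity) ?_
  obtain ⟨Q, hQ⟩ := exists_nat_ge (max 1 (3 * d / (c - d)))
  filter_upwards [eventually_ge_atTop (Q * Q * s)] with N hN
  -- with `q ^ 2 ≤ N / s < (q + 1) ^ 2`, the gap is `s * (q + 1)` and the classes have size `q + 1`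
  set q := Nat.sqrt (N / s) with hq
  have hs0 : 0 < s := by omega
  have hQq : Q ≤ q := Nat.le_sqrt.2 ((Nat.le_div_iff_mul_le hs0).2 hN)
  have hq1 : q * q * s ≤ N := (Nat.le_div_iff_mul_le hs0).1 (Nat.sqrt_le _)
  have hq2 : N ≤ s * (q + 1) * (q + 1) := by
    have h1 : N / s < (q + 1) * (q + 1) := Nat.lt_succ_sqrt _
    have h2 := (Nat.div_lt_iff_lt_mul hs0).1 h1
    rw [mul_assoc, mul_comm]; exact h2.le
  have hs0' : (0 : ℝ) < s := by exact_mod_cast hs0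
  have hqQ' : max 1 (3 * d / (c - d)) ≤ (q : ℝ) := hQ.trans (by exact_mod_cast hQq)
  have hq1' : (1 : ℝ) ≤ q := (le_max_left _ _).trans hqQ'
  have hqc : 3 * d ≤ q * (c - d) := by
    have := (le_max_right _ _).trans hqQ'
    rwa [div_le_iff₀ (sub_pos.2 hdc)] at this
  have hN1 : (q : ℝ) * q * s ≤ N := by exact_mod_cast hq1
  have hcd : d * ((q + 1 : ℕ) : ℝ) * ((s * (q + 1) : ℕ) : ℝ) ≤ c * N := by
    push_cast
    have h1 : d * (q + 1) * (q + 1) ≤ c * (q * q) := by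
      have h3 : 3 * d * q ≤ q * (c - d) * q := by gcongr
      have h4 : d ≤ d * q := le_mul_of_one_le_right hd0.le hq1'
      linarith [h3, h4]
    calc d * (q + 1) * (s * (q + 1)) = (d * (q + 1) * (q + 1)) * s := by ring
      _ ≤ c * (q * q) * s := by gcongr
      _ = c * (q * q * s) := by ring
      _ ≤ c * N := by
        have : 0 < c := hd0.trans hdc
        gcongr
  refine (measure_sum_ge_le_of_residue (fun i ω => hg0 _) (Nat.mul_pos hs0 q.succ_pos) hq2 hcd
    (fun r => hclass (q + 1) r q.succ_pos)).trans ?_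
  have hk := hK ((q + 1 : ℕ) : ℝ) (Nat.cast_nonneg _)
  have hsqrt : Real.sqrt N ≤ s * ((q + 1 : ℕ) : ℝ) := by
    refine Real.sqrt_le_iff.2 ⟨by positivity, ?_⟩
    have h1 : (N : ℝ) ≤ s * (q + 1 : ℕ) * (q + 1 : ℕ) := by exact_mod_cast hq2
    have h2 : (1 : ℝ) ≤ s := by exact_mod_cast hs0
    calc (N : ℝ) ≤ s * (q + 1 : ℕ) * (q + 1 : ℕ) := h1
      _ ≤ s * (s * (q + 1 : ℕ) * (q + 1 : ℕ)) := le_mul_of_one_le_left (by positivity) h2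
      _ = _ := by ring
  calc _ = s * (((q + 1 : ℕ) : ℝ) * (1 + (q + 1 : ℕ) * τ) * Real.exp (-(a * (q + 1 : ℕ)))) := by
        push_cast; ring
    _ ≤ s * (K * Real.exp (-(a / 2 * (q + 1 : ℕ)))) := by gcongr
    _ ≤ s * (K * Real.exp (-(a / (2 * s) * Real.sqrt N))) := by
        refine mul_le_mul_of_nonneg_left (mul_le_mul_of_nonneg_left
          (Real.exp_le_exp.2 (neg_le_neg ?_)) hK0) hs0'.le
        calc a / (2 * s) * Real.sqrt N ≤ a / (2 * s) * (s * (q + 1 : ℕ)) := by gcongr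
          _ = a / 2 * (q + 1 : ℕ) := by field_simp
    _ = _ := by ring

end WeakDependence

/-! ### Lipschitz observables of arbitrary sign -/

section Signed

variable {Ω : Type*} [MeasurableSpace Ω] {P : Measure Ω}

/-- An observable is dominated by its truncation `max g (-R)`, which is bounded below and whose
expectation tends to that of `g`. -/
theorem HasUpperDeviation.of_lipschitz [IsProbabilityMeasure P] {x : ℕ → Ω → ℝ} {ρ : ℕ → ℝ}
    (h : HasUpperDeviation P x ρ) (hx : Measurable (x 0)) {g : ℝ → ℝ} {L : NNReal}
    (hg : LipschitzWith L g) (hint : Integrable (fun ω => g (x 0 ω)) P) {c : ℝ}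
    (hc : ∫ ω, g (x 0 ω) ∂P < c) :
    IsExpSmall P ρ (fun N => {ω | c * N ≤ ∑ i ∈ Finset.range N, g (x i ω)}) := by
  have hlim : Tendsto (fun R : ℕ => ∫ ω, max (g (x 0 ω)) (-(R : ℝ)) ∂P) atTop
      (𝓝 (∫ ω, g (x 0 ω) ∂P)) := by
    refine tendsto_integral_of_dominated_convergence (fun ω => |g (x 0 ω)|)
      (fun R => (((hg.continuous.measurable.comp hx).max
        measurable_const).aestronglyMeasurable)) hint.abs (fun R => ae_of_all _ fun ω => ?_)
      (ae_of_all _ fun ω => ?_)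
    · rw [Real.norm_eq_abs, abs_le]
      exact ⟨(neg_abs_le _).trans (le_max_left _ _), max_le (le_abs_self _)
        ((neg_nonpos.2 (Nat.cast_nonneg R)).trans (abs_nonneg _))⟩
    · refine tendsto_const_nhds.congr' ?_
      filter_upwards [tendsto_natCast_atTop_atTop.eventually_ge_atTop (-g (x 0 ω))] with R hR
      exact (max_eq_left (by linarith)).symm
  obtain ⟨R, hR⟩ := (hlim.eventually (gt_mem_nhds hc)).exists
  have hmaxint : Integrable (fun ω => max (g (x 0 ω)) (-(R : ℝ))) P :=
    hint.sup (integrable_const _)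
  refine (h (fun u => max (g u) (-(R : ℝ)) + R) L ?_ ?_ (c + R) ?_).mono ?_
  · simpa using (hg.max_const (-(R : ℝ))).add (LipschitzWith.const (R : ℝ))
  · intro u
    linarith [le_max_right (g u) (-(R : ℝ))]
  · rw [integral_add hmaxint (integrable_const _)]
    simpa using hR
  · intro N _ ω hω
    simp only [Set.mem_ofPred_eq, Finset.sum_add_distrib, Finset.sum_const, Finset.card_range,
      nsmul_eq_mul] at hω ⊢
    have : ∑ i ∈ Finset.range N, g (x i ω) ≤ ∑ i ∈ Finset.range N, max (g (x i ω)) (-(R : ℝ)) :=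
      Finset.sum_le_sum fun i _ => le_max_left _ _
    linarith

end Signed

/-! ### Lipschitz majorants of the truncated identity -/

/-- A continuous piecewise linear, odd approximation of `u ↦ u * 1_{|u| < r}`, equal to it off the
set `r - 2 * δ < |u| < r`. -/
noncomputable def cutId (r δ u : ℝ) : ℝ :=
  max (-max 0 (r / (2 * δ) * (r - |u|))) (min u (max 0 (r / (2 * δ) * (r - |u|))))

/-- A piecewise linear bump, equal to `1` for `||u| - r| ≤ 2 * δ` and to `0` for
`||u| - r| ≥ 4 * δ`. -/
noncomputable def edgeBump (r δ u : ℝ) : ℝ :=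
  max 0 (min 1 (2 - 1 / (2 * δ) * |(|u| - r)|))

/-- A Lipschitz majorant of `u ↦ (u - a) * 1_{|u - a| < b}` for all small shifts `a` and all `b`
close to `r`, see `truncId_sub_le_cutMajorant`; the constant `D` bounds the jumps. -/
noncomputable def cutMajorant (D r δ u : ℝ) : ℝ :=
  cutId r δ u + δ + D * edgeBump r δ u

section Majorant

variable {r δ : ℝ}

theorem LipschitzWith.const_mul_real {f : ℝ → ℝ} {K : NNReal} (hf : LipschitzWith K f) (a : ℝ) :
    LipschitzWith (‖a‖₊ * K) fun u => a * f u :=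
  (lipschitzWith_smul a).comp hf

theorem exists_lipschitzWith_cutMajorant (D r δ : ℝ) :
    ∃ K, LipschitzWith K (cutMajorant D r δ) := by
  have habs : LipschitzWith 1 fun u : ℝ => |u| := lipschitzWith_one_norm
  have h1 := ((((LipschitzWith.const r).sub habs).const_mul_real (r / (2 * δ))).const_max 0)
  have h2 := h1.neg.max (LipschitzWith.id.min h1)
  have h3 := ((((LipschitzWith.const (2 : ℝ)).sub
    ((habs.comp (habs.sub (LipschitzWith.const r))).const_mul_real (1 / (2 * δ)))).const_min
      1).const_max 0)
  exact ⟨_, (h2.add (LipschitzWith.const δ)).add (h3.const_mul_real D)⟩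

theorem cutId_neg (r δ u : ℝ) : cutId r δ (-u) = -cutId r δ u := by
  unfold cutId
  rw [abs_neg]
  have h0 : 0 ≤ max 0 (r / (2 * δ) * (r - |u|)) := le_max_left _ _
  generalize max 0 (r / (2 * δ) * (r - |u|)) = w at *
  rcases le_total u w with h1 | h1 <;> rcases le_total (-u) w with h2 | h2
  · rw [min_eq_left h1, min_eq_left h2, max_eq_right (by linarith), max_eq_right (by linarith)]
  · rw [min_eq_left h1, min_eq_right h2, max_eq_right (by linarith), max_eq_left (by linarith),
      neg_neg]
  · rw [min_eq_right h1, min_eq_left h2, max_eq_left (by linarith), max_eq_right (by linarith)]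
  · rw [min_eq_right h1, min_eq_right h2, max_eq_right (by linarith)]
    linarith

theorem abs_cutId_le (r δ u : ℝ) : |cutId r δ u| ≤ |u| := by
  unfold cutId
  have h0 : 0 ≤ max 0 (r / (2 * δ) * (r - |u|)) := le_max_left _ _
  generalize max 0 (r / (2 * δ) * (r - |u|)) = w at *
  rw [abs_le]
  refine ⟨le_max_of_le_right (le_min (neg_abs_le u) ((neg_nonpos.2 (abs_nonneg u)).trans h0)),
    max_le ((neg_nonpos.2 h0).trans (abs_nonneg u)) ((min_le_left _ _).trans (le_abs_self u))⟩

theorem cutId_eq_zero (hr : 0 ≤ r) (hδ : 0 < δ) {u : ℝ} (h : r ≤ |u|) : cutId r δ u = 0 := by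
  have : max 0 (r / (2 * δ) * (r - |u|)) = 0 :=
    max_eq_left (mul_nonpos_of_nonneg_of_nonpos (by positivity) (by linarith))
  unfold cutId
  rw [this, neg_zero, max_eq_left (min_le_right _ _)]

theorem cutId_eq_self (hr : 0 ≤ r) (hδ : 0 < δ) {u : ℝ} (h : |u| ≤ r - 2 * δ) :
    cutId r δ u = u := by
  have h1 : |u| ≤ max 0 (r / (2 * δ) * (r - |u|)) := by
    refine le_max_of_le_right ?_
    calc |u| ≤ r := by linarith
      _ = r / (2 * δ) * (2 * δ) := by field_simp
      _ ≤ r / (2 * δ) * (r - |u|) := by gcongr; linarith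
  unfold cutId
  have h2 := neg_abs_le u
  rw [min_eq_left ((le_abs_self u).trans h1), max_eq_right (by linarith)]

theorem edgeBump_nonneg (r δ u : ℝ) : 0 ≤ edgeBump r δ u := le_max_left _ _

theorem edgeBump_le_one (r δ u : ℝ) : edgeBump r δ u ≤ 1 :=
  max_le zero_le_one (min_le_left _ _)

theorem edgeBump_eq_one (hδ : 0 < δ) {u : ℝ} (h : |(|u| - r)| ≤ 2 * δ) : edgeBump r δ u = 1 := by
  have : 1 / (2 * δ) * |(|u| - r)| ≤ 1 := by
    rw [div_mul_eq_mul_div, one_mul, div_le_one (by positivity)]; exact h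
  unfold edgeBump
  rw [min_eq_left (by linarith), max_eq_right zero_le_one]

theorem edgeBump_eq_zero (hδ : 0 < δ) {u : ℝ} (h : 4 * δ ≤ |(|u| - r)|) : edgeBump r δ u = 0 := by
  have : 2 ≤ 1 / (2 * δ) * |(|u| - r)| := by
    rw [div_mul_eq_mul_div, one_mul, le_div_iff₀ (by positivity)]; linarith
  unfold edgeBump
  exact max_eq_left ((min_le_right _ _).trans (by linarith))

theorem truncId_sub_le_cutMajorant (hδ : 0 < δ) (hr : 0 ≤ r) {D : ℝ} (hD : 2 * r + δ ≤ D)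
    {a b : ℝ} (ha : |a| ≤ δ) (hrb : r ≤ b) (hbr : b ≤ r + δ) (u : ℝ) :
    (if |u - a| < b then u - a else 0) ≤ cutMajorant D r δ u := by
  unfold cutMajorant
  have ha' := abs_le.1 ha
  have hb0 := edgeBump_nonneg r δ u
  have hDb : 0 ≤ D * edgeBump r δ u := mul_nonneg (by linarith) hb0
  have htri : |u| ≤ |u - a| + |a| := by
    simpa using abs_add_le (u - a) a
  have htri' : |u - a| ≤ |u| + |a| := abs_sub u a
  rcases le_or_gt |u| (r - 2 * δ) with h | h
  · rw [cutId_eq_self hr hδ h]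
    split_ifs with hb
    · linarith
    · exact absurd (by linarith : |u - a| < b) hb
  · rcases le_or_gt r |u| with h' | h'
    · rw [cutId_eq_zero hr hδ h']
      split_ifs with hb
      · rw [edgeBump_eq_one hδ (by rw [abs_le]; constructor <;> linarith)]
        linarith [le_abs_self (u - a)]
      · linarith
    · rw [edgeBump_eq_one hδ (by rw [abs_le]; constructor <;> linarith)]
      have hq := (abs_le.1 (abs_cutId_le r δ u)).1
      split_ifs with hb
      · linarith [le_abs_self (u - a)]
      · linarith

end Majorant

/-! ### Expectations under a symmetric bounded density -/

section Density

variable {Ω : Type*} [MeasurableSpace Ω] {P : Measure Ω} {X : Ω → ℝ} {f₀ : ℝ → ℝ}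

theorem integral_comp_neg_of_symm_density (hX : Measurable X) (hf_meas : Measurable f₀)
    (hf_symm : ∀ u, f₀ (-u) = f₀ u)
    (hlaw : P.map X = volume.withDensity (fun u => ENNReal.ofReal (f₀ u)))
    {F : ℝ → ℝ} (hF : Measurable F) : ∫ ω, F (-X ω) ∂P = ∫ ω, F (X ω) ∂P := by
  have key : ∀ G : ℝ → ℝ, Measurable G →
      ∫ ω, G (X ω) ∂P = ∫ u, (ENNReal.ofReal (f₀ u)).toReal • G u := by
    intro G hG
    rw [← integral_map hX.aemeasurable hG.aestronglyMeasurable, hlaw,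
      integral_withDensity_eq_integral_toReal_smul hf_meas.ennreal_ofReal
        (ae_of_all _ fun _ => ENNReal.ofReal_lt_top)]
  rw [key F hF, key (fun u => F (-u)) (hF.comp measurable_neg), ← integral_neg_eq_self]
  simp only [hf_symm, neg_neg]

theorem measure_mem_Icc_le_of_density (hX : Measurable X) {M : ℝ} (hM : 0 ≤ M)
    (hf_bdd : ∀ u, f₀ u ≤ M)
    (hlaw : P.map X = volume.withDensity (fun u => ENNReal.ofReal (f₀ u)))
    {l u : ℝ} (hlu : l ≤ u) : P.real {ω | X ω ∈ Set.Icc l u} ≤ M * (u - l) := by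
  have h : P {ω | X ω ∈ Set.Icc l u} ≤ ENNReal.ofReal (M * (u - l)) := by
    calc P {ω | X ω ∈ Set.Icc l u} = P.map X (Set.Icc l u) :=
          (Measure.map_apply hX measurableSet_Icc).symm
      _ = ∫⁻ v in Set.Icc l u, ENNReal.ofReal (f₀ v) := by
          rw [hlaw, withDensity_apply _ measurableSet_Icc]
      _ ≤ ∫⁻ _ in Set.Icc l u, ENNReal.ofReal M :=
          lintegral_mono fun v => ENNReal.ofReal_le_ofReal (hf_bdd v)
      _ = ENNReal.ofReal (M * (u - l)) := by
          rw [setLIntegral_const, Real.volume_Icc, ENNReal.ofReal_mul hM]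
  exact ENNReal.toReal_le_of_le_ofReal (mul_nonneg hM (sub_nonneg.2 hlu)) h

theorem measurable_edgeBump (r δ : ℝ) : Measurable (edgeBump r δ) := by
  unfold edgeBump; fun_prop

theorem measurable_cutId (r δ : ℝ) : Measurable (cutId r δ) := by
  unfold cutId; fun_prop

theorem abs_cutId_le_radius {r δ : ℝ} (hr : 0 ≤ r) (hδ : 0 < δ) (u : ℝ) : |cutId r δ u| ≤ r := by
  rcases le_or_gt r |u| with h | h
  · rw [cutId_eq_zero hr hδ h]; simpa using hr
  · exact (abs_cutId_le r δ u).trans h.le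

theorem integrable_edgeBump [IsFiniteMeasure P] (hX : Measurable X) (r δ : ℝ) :
    Integrable (fun ω => edgeBump r δ (X ω)) P :=
  Integrable.of_bound ((measurable_edgeBump r δ).comp hX).aestronglyMeasurable 1
      (ae_of_all _ fun ω => by
        rw [Real.norm_eq_abs, abs_of_nonneg (edgeBump_nonneg _ _ _)]
        exact edgeBump_le_one _ _ _)

theorem integrable_cutId [IsFiniteMeasure P] (hX : Measurable X) {r δ : ℝ} (hr : 0 ≤ r)
    (hδ : 0 < δ) : Integrable (fun ω => cutId r δ (X ω)) P :=
  Integrable.of_bound ((measurable_cutId r δ).comp hX).aestronglyMeasurable r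
      (ae_of_all _ fun _ => abs_cutId_le_radius hr hδ _)

theorem integral_edgeBump_le [IsProbabilityMeasure P] (hX : Measurable X) {M : ℝ} (hM : 0 ≤ M)
    (hf_bdd : ∀ u, f₀ u ≤ M)
    (hlaw : P.map X = volume.withDensity (fun u => ENNReal.ofReal (f₀ u)))
    {r δ : ℝ} (hδ : 0 < δ) : ∫ ω, edgeBump r δ (X ω) ∂P ≤ 16 * M * δ := by
  set S : Set ℝ := Set.Icc (r - 4 * δ) (r + 4 * δ) ∪ Set.Icc (-r - 4 * δ) (-r + 4 * δ) with hS
  have hSm : MeasurableSet S := measurableSet_Icc.union measurableSet_Icc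
  have hmeas : MeasurableSet {ω | X ω ∈ S} := hX hSm
  have hle : ∀ ω, edgeBump r δ (X ω) ≤ {ω | X ω ∈ S}.indicator (fun _ => (1 : ℝ)) ω := by
    intro ω
    by_cases h : X ω ∈ S
    · rw [Set.indicator_of_mem (show ω ∈ {ω | X ω ∈ S} from h)]
      exact edgeBump_le_one _ _ _
    · rw [Set.indicator_of_notMem (show ω ∉ {ω | X ω ∈ S} from h)]
      refine (edgeBump_eq_zero hδ ?_).le
      by_contra! hcon
      obtain ⟨h1, h2⟩ := abs_lt.1 hcon
      refine h ?_
      rcases abs_cases (X ω) with ⟨h3, _⟩ | ⟨h3, _⟩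
      · exact Or.inl ⟨by linarith, by linarith⟩
      · exact Or.inr ⟨by linarith, by linarith⟩
  have hint : Integrable (fun ω => edgeBump r δ (X ω)) P :=
    integrable_edgeBump hX r δ
  calc ∫ ω, edgeBump r δ (X ω) ∂P
      ≤ ∫ ω, {ω | X ω ∈ S}.indicator (fun _ => (1 : ℝ)) ω ∂P :=
        integral_mono hint ((integrable_const 1).indicator hmeas) hle
    _ = P.real {ω | X ω ∈ S} := integral_indicator_one hmeas
    _ ≤ P.real {ω | X ω ∈ Set.Icc (r - 4 * δ) (r + 4 * δ)}
        + P.real {ω | X ω ∈ Set.Icc (-r - 4 * δ) (-r + 4 * δ)} := measureReal_union_le _ _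
    _ ≤ M * ((r + 4 * δ) - (r - 4 * δ)) + M * ((-r + 4 * δ) - (-r - 4 * δ)) :=
        add_le_add
          (measure_mem_Icc_le_of_density hX hM hf_bdd hlaw (by linarith))
          (measure_mem_Icc_le_of_density hX hM hf_bdd hlaw (by linarith))
    _ = _ := by ring

theorem integrable_cutMajorant [IsFiniteMeasure P] (hX : Measurable X) {r δ : ℝ} (hr : 0 ≤ r)
    (hδ : 0 < δ) (D : ℝ) : Integrable (fun ω => cutMajorant D r δ (X ω)) P := by
  exact ((integrable_cutId hX hr hδ).add (integrable_const _)).add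
    ((integrable_edgeBump hX r δ).const_mul D)

/-- The odd part of the majorant has mean zero by symmetry, and the rest is of order `δ`. -/
theorem integral_cutMajorant_le [IsProbabilityMeasure P] (hX : Measurable X)
    (hf_meas : Measurable f₀) (hf_symm : ∀ u, f₀ (-u) = f₀ u) {M : ℝ} (hM : 0 ≤ M)
    (hf_bdd : ∀ u, f₀ u ≤ M)
    (hlaw : P.map X = volume.withDensity (fun u => ENNReal.ofReal (f₀ u)))
    {r δ : ℝ} (hr : 0 ≤ r) (hδ : 0 < δ) {D : ℝ} (hD : 0 ≤ D) :
    ∫ ω, cutMajorant D r δ (X ω) ∂P ≤ (1 + 16 * D * M) * δ := by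
  have hc : Integrable (fun ω => cutId r δ (X ω)) P :=
    integrable_cutId hX hr hδ
  have hb : Integrable (fun ω => edgeBump r δ (X ω)) P :=
    integrable_edgeBump hX r δ
  have hzero : ∫ ω, cutId r δ (X ω) ∂P = 0 := by
    have h := integral_comp_neg_of_symm_density hX hf_meas hf_symm hlaw (measurable_cutId r δ)
    simp only [cutId_neg, integral_neg] at h
    linarith
  have hbl := integral_edgeBump_le hX hM hf_bdd hlaw (r := r) hδ
  have hsplit : ∫ ω, cutMajorant D r δ (X ω) ∂P
      = ∫ ω, cutId r δ (X ω) ∂P + δ + D * ∫ ω, edgeBump r δ (X ω) ∂P := by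
    have hcδ : Integrable (fun ω => cutId r δ (X ω) + δ) P := hc.add (integrable_const _)
    unfold cutMajorant
    rw [integral_add hcδ (hb.const_mul _), integral_add hc (integrable_const _),
      integral_const_mul]
    simp
  rw [hsplit, hzero]
  nlinarith [mul_le_mul_of_nonneg_left hbl hD]

end Density

/-! ### The separation statistic -/

/-- Since `N₁ + N₂ = N` and the two partial sums add up to `N θ_N`, the statistic is the mean of
the truncated centred observations. -/
theorem sepStat_eq {N : ℕ} (hN : 1 ≤ N) (x : ℕ → ℝ) (b : ℝ) :
    sepStat N x b = (1 / (N : ℝ)) * ∑ i ∈ Finset.range N,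
      (if |x i - sampleMean N x| < b then x i - sampleMean N x else 0) := by
  have hN0 : (N : ℝ) ≠ 0 := by positivity
  have habn : abnormalIdx N x b
      = {i ∈ Finset.range N | ¬ |x i - sampleMean N x| < b} := by
    simp only [abnormalIdx, not_lt]
  have hcard : ((ordinaryIdx N x b).card : ℝ) + (abnormalIdx N x b).card = N := by
    rw [habn, ordinaryIdx]
    exact_mod_cast (Finset.card_filter_add_card_filter_not _).trans (Finset.card_range N)
  have hsum : ∑ i ∈ ordinaryIdx N x b, x i + ∑ i ∈ abnormalIdx N x b, x i
      = N * sampleMean N x := by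
    rw [habn, ordinaryIdx, Finset.sum_filter_add_sum_filter_not, sampleMean]
    field_simp
  rw [← Finset.sum_filter, Finset.sum_sub_distrib, Finset.sum_const, nsmul_eq_mul]
  change _ = 1 / (N : ℝ) * (∑ i ∈ ordinaryIdx N x b, x i
    - ((ordinaryIdx N x b).card : ℝ) * sampleMean N x)
  unfold sepStat
  rw [eq_sub_of_add_eq' hcard, eq_sub_of_add_eq' hsum]
  field_simp
  ring

/-- If every term of the mean has a majorant in both directions, so has the statistic. -/
theorem abs_sepStat_le {N : ℕ} (hN : 1 ≤ N) {x : ℕ → ℝ} {b C : ℝ} {G : ℝ → ℝ}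
    (hG : ∀ a, |a| = |sampleMean N x| → ∀ u, (if |u - a| < b then u - a else 0) ≤ G u)
    (h₁ : ∑ i ∈ Finset.range N, G (x i) ≤ C * N)
    (h₂ : ∑ i ∈ Finset.range N, G (-x i) ≤ C * N) : |sepStat N x b| ≤ C := by
  have hN0 : (0 : ℝ) < N := by exact_mod_cast hN
  have hup : ∑ i ∈ Finset.range N,
      (if |x i - sampleMean N x| < b then x i - sampleMean N x else 0) ≤ C * N :=
    (Finset.sum_le_sum fun i _ => hG _ rfl (x i)).trans h₁
  have hlow : -∑ i ∈ Finset.range N,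
      (if |x i - sampleMean N x| < b then x i - sampleMean N x else 0) ≤ C * N := by
    rw [← Finset.sum_neg_distrib]
    refine (Finset.sum_le_sum fun i _ => ?_).trans h₂
    refine le_trans (le_of_eq ?_) (hG (-sampleMean N x) (abs_neg _) (-x i))
    rw [show -x i - -sampleMean N x = -(x i - sampleMean N x) by ring, abs_neg]
    split_ifs <;> simp
  rw [sepStat_eq hN, one_div, ← div_eq_inv_mul, abs_div, abs_of_pos hN0, div_le_iff₀ hN0]
  exact abs_le'.2 ⟨hup, hlow⟩

section Separation

variable {Ω : Type*} [MeasurableSpace Ω] {P : Measure Ω}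

/-- Upper deviation bounds for Lipschitz observables control the separation statistic uniformly
in the threshold: the thresholds are discretized with mesh `δ`, and `|θ_N| < δ` off an
exponentially small event. -/
theorem HasUpperDeviation.isExpSmall_sepStatSup [IsProbabilityMeasure P] {x : ℕ → Ω → ℝ}
    {ρ : ℕ → ℝ} (hρ : ∀ N, 0 ≤ ρ N) (hdev : HasUpperDeviation P x ρ)
    (hx : ∀ i, Measurable (x i)) {f₀ : ℝ → ℝ} (hf_meas : Measurable f₀)
    (hf_nonneg : ∀ u, 0 ≤ f₀ u) (hf_symm : ∀ u, f₀ (-u) = f₀ u) (hf_bdd : ∃ M : ℝ, ∀ u, f₀ u ≤ M)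
    (hlaw : P.map (x 0) = volume.withDensity (fun u => ENNReal.ofReal (f₀ u)))
    (hint : Integrable (x 0) P) {κ B : ℝ} (hκ : 0 < κ) (hκB : κ < B) {C : ℝ} (hC : 0 < C) :
    IsExpSmall P ρ (fun N => {ω | C < sepStatSup N (fun i => x i ω) κ B}) := by
  obtain ⟨M, hM⟩ := hf_bdd
  have hM0 : 0 ≤ M := (hf_nonneg 0).trans (hM 0)
  have hB : 0 < B := hκ.trans hκB
  set D := 2 * B + 1 with hD
  have hD0 : 0 ≤ D := by positivity
  set δ := min 1 (C / (2 * (1 + 16 * D * M))) with hδ_def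
  have hδ : 0 < δ := lt_min one_pos (by positivity)
  have hδ1 : δ ≤ 1 := min_le_left _ _
  have hδC : (1 + 16 * D * M) * δ < C := by
    have h1 : δ ≤ C / (2 * (1 + 16 * D * M)) := min_le_right _ _
    rw [le_div_iff₀ (by positivity)] at h1
    linarith
  have hmean_neg := integral_comp_neg_of_symm_density (hx 0) hf_meas hf_symm hlaw measurable_id
  simp only [id, integral_neg] at hmean_neg
  have hmean : ∫ ω, x 0 ω ∂P = 0 := by linarith
  have hpos := hdev.of_lipschitz (hx 0) LipschitzWith.id (c := δ) hint (by simpa [hmean] using hδ)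
  have hneg := hdev.of_lipschitz (hx 0) LipschitzWith.id.neg (c := δ) hint.neg
    (by simpa [integral_neg, hmean] using hδ)
  have hgrid : ∀ k ∈ Finset.range (⌊B / δ⌋₊ + 1),
      IsExpSmall P ρ (fun N =>
        {ω | C * N ≤ ∑ i ∈ Finset.range N, cutMajorant D (k * δ) δ (x i ω)} ∪
        {ω | C * N ≤ ∑ i ∈ Finset.range N, cutMajorant D (k * δ) δ (-x i ω)}) := by
    intro k _
    have hr : 0 ≤ (k : ℝ) * δ := by positivity
    obtain ⟨K, hK⟩ := exists_lipschitzWith_cutMajorant D (k * δ) δ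
    have hE := (integral_cutMajorant_le (hx 0) hf_meas hf_symm hM0 hM hlaw hr hδ hD0).trans_lt hδC
    refine IsExpSmall.union hρ (hdev.of_lipschitz (hx 0) hK
      (integrable_cutMajorant (hx 0) hr hδ D) hE) ?_
    refine hdev.of_lipschitz (hx 0) (hK.comp LipschitzWith.id.neg)
      (integrable_cutMajorant (hx 0).neg hr hδ D) ?_
    simp only [Function.comp_apply]
    exact (integral_comp_neg_of_symm_density (hx 0) hf_meas hf_symm hlaw
      hK.continuous.measurable).trans_lt hE
  refine ((hpos.union hρ hneg).union hρ (IsExpSmall.biUnion hρ _ hgrid)).mono ?_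
  intro N hN ω hω
  by_contra hcon
  simp only [Set.mem_union, Set.mem_iUnion, Set.mem_ofPred_eq, not_or, not_exists, not_le, id,
    Pi.neg_apply, Finset.sum_neg_distrib]
    at hcon
  obtain ⟨⟨hp, hn⟩, hG⟩ := hcon
  have hN0 : (0 : ℝ) < N := by exact_mod_cast hN
  have hθ : |sampleMean N (fun i => x i ω)| ≤ δ := by
    rw [sampleMean, one_div, ← div_eq_inv_mul, abs_div, abs_of_pos hN0, div_le_iff₀ hN0]
    exact abs_le'.2 ⟨hp.le, hn.le⟩
  refine absurd (Set.mem_ofPred_eq ▸ hω : C < _) (not_lt.2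
    (csSup_le ((Set.nonempty_Icc.2 hκB.le).image _) ?_))
  rintro _ ⟨b, ⟨hb1, hb2⟩, rfl⟩
  have hb0 : 0 ≤ b / δ := by have := hκ.trans_le hb1; positivity
  have hk : ⌊b / δ⌋₊ ∈ Finset.range (⌊B / δ⌋₊ + 1) :=
    Finset.mem_range.2 (Nat.lt_succ_of_le (Nat.floor_mono (by gcongr)))
  have hk1 : (⌊b / δ⌋₊ : ℝ) * δ ≤ b := (le_div_iff₀ hδ).1 (Nat.floor_le hb0)
  have hk2 : b ≤ (⌊b / δ⌋₊ : ℝ) * δ + δ := by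
    have := (div_lt_iff₀ hδ).1 (Nat.lt_floor_add_one (b / δ))
    linarith
  obtain ⟨hG1, hG2⟩ := hG _ hk
  exact abs_sepStat_le hN (fun a ha u => truncId_sub_le_cutMajorant hδ (by positivity)
    (by linarith) (ha.trans_le hθ) hk1 hk2 u) hG1.le hG2.le

end Separation
theorem theorem1 {Ω : Type*} [MeasurableSpace Ω] (P₀ : Measure Ω) [IsProbabilityMeasure P₀]
    (x : ℕ → Ω → ℝ) (hx : ∀ i, Measurable (x i))
    (f₀ : ℝ → ℝ) (hf_meas : Measurable f₀) (hf_nonneg : ∀ u, 0 ≤ f₀ u)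
    (hf_symm : ∀ u, f₀ (-u) = f₀ u) (hf_bdd : ∃ M : ℝ, ∀ u, f₀ u ≤ M)
    (hlaw : ∀ i, P₀.map (x i) = volume.withDensity (fun u => ENNReal.ofReal (f₀ u)))
    (hcramer : UniformCramer P₀ x) :
    (IsPsiMixing P₀ x →
      ∀ κ B : ℝ, 0 < κ → κ < B →
        ∃ L₁ : ℝ, 0 < L₁ ∧ ∃ L₂ : ℝ → ℝ, ∀ C : ℝ, 0 < C → 0 < L₂ C ∧
          ∀ N : ℕ, 1 ≤ N →
            P₀.real {ω | C < sepStatSup N (fun i => x i ω) κ B}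
              ≤ L₁ * Real.exp (-(L₂ C * (N : ℝ)))) ∧
    (∀ (θ : ℕ → ℝ) (ψ : ∀ n m : ℕ, ((Fin n → ℝ) → ℝ) → ((Fin m → ℝ) → ℝ) → ℝ) (β : ℝ),
      IsWeakDependent P₀ x θ boundedLipschitz ψ → HasExpGrowth ψ →
      0 < β → (∀ r : ℕ, 1 ≤ r → θ r ≤ Real.exp (-(β * (r : ℝ)))) →
      ∀ κ B : ℝ, 0 < κ → κ < B →
        ∃ L₁ : ℝ, 0 < L₁ ∧ ∃ L₂ : ℝ → ℝ, ∀ C : ℝ, 0 < C → 0 < L₂ C ∧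
          ∀ N : ℕ, 1 ≤ N →
            P₀.real {ω | C < sepStatSup N (fun i => x i ω) κ B}
              ≤ L₁ * Real.exp (-(L₂ C * Real.sqrt (N : ℝ)))) := by
  have hmap : ∀ i, P₀.map (x i) = P₀.map (x 0) := fun i => (hlaw i).trans (hlaw 0).symm
  have hint : Integrable (x 0) P₀ := integrable_of_mem_interior_integrableExpSet
    (hcramer.zero_mem_interior hx LipschitzWith.id 0)
  -- the prefactor is the universal constant `e`, so that it depends neither on `C` nor on `N`
  have main : ∀ ρ : ℕ → ℝ, (∀ N, 0 ≤ ρ N) → HasUpperDeviation P₀ x ρ →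
      ∀ κ B : ℝ, 0 < κ → κ < B →
        ∃ L₁ : ℝ, 0 < L₁ ∧ ∃ L₂ : ℝ → ℝ, ∀ C : ℝ, 0 < C → 0 < L₂ C ∧
          ∀ N : ℕ, 1 ≤ N →
            P₀.real {ω | C < sepStatSup N (fun i => x i ω) κ B}
              ≤ L₁ * Real.exp (-(L₂ C * ρ N)) := by
    intro ρ hρ hdev κ B hκ hκB
    have h : ∀ C : ℝ, ∃ a : ℝ, 0 < C → 0 < a ∧ ∀ N : ℕ, 1 ≤ N →
        P₀.real {ω | C < sepStatSup N (fun i => x i ω) κ B}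
          ≤ Real.exp 1 * Real.exp (-(a * ρ N)) := by
      intro C
      by_cases hC : 0 < C
      · obtain ⟨a, ha⟩ := (hdev.isExpSmall_sepStatSup hρ hx hf_meas hf_nonneg hf_symm hf_bdd
          (hlaw 0) hint hκ hκB hC).exists_rate
        exact ⟨a, fun _ => ha⟩
      · exact ⟨0, fun hC' => absurd hC' hC⟩
    choose L₂ hL₂ using h
    exact ⟨Real.exp 1, Real.exp_pos 1, L₂, hL₂⟩
  refine ⟨fun hmix => main _ (fun N => Nat.cast_nonneg N)
    (hmix.hasUpperDeviation hx hmap hcramer), ?_⟩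
  intro θ ψ β hwd hψ hβ hθ
  exact main _ (fun N => Real.sqrt_nonneg N)
    (hwd.hasUpperDeviation hψ hβ hθ hx hmap hcramer)
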